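/- Let $V$ be a finite-dimensional real Euclidean Jordan algebra with identity $1$: a commutative, not necessarily associative, unital real algebra with $(ab)a^2=a(ba^2)$, which carries an inner product for which every $L(x):y\mapsto xy$ is symmetric. Let $Q=\{x^2:x\in V\}$ be its cone of squares, $\Omega$ the interior of $Q$, and write $x\le y$ if $y-x\in Q$. An element $x$ is invertible if $xy=1$ for some $y$ in the subalgebra $\mathbb{R}[x]$ generated by $1$ and $x$; this $y$ is then unique and is denoted $x^{-1}$. Put $P(x)=2L(x)^2-L(x^2)$. Let $X=\{u\in V:-1\le u\le 1\}$ with the subspace topology, and for $u\in X$ put $\widetilde u=\frac{1-u}{2}$. Then for all $u\in X$ and $a\in\Omega$ the elements $a$ and $\widetilde u+a^{-1}$ are invertible, so that $$u\boxplus a:=1-2\widetilde u+2P(\widetilde u)(\widetilde u+a^{-1})^{-1}$$ is defined. There is a unique injective action $X\times Q\to X$, $(u,a)\mapsto u\boxplus a$, of the additive semigroup $Q$ on $X$ which is given by this formula for $a\in\Omega$, and with this action $X$ is the Wiener–Hopf compactification of $Q\subset V$. Here an injective action of $Q$ on $X$ is a continuous map $X\times Q\to X$, $(u,a)\mapsto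 u\boxplus a$, with $u\boxplus 0=u$ and $u\boxplus(a+b)=(u\boxplus a)\boxplus b$, such that $u\mapsto u\boxplus a$ is injective for every $a\in Q$. That $X$ is the Wiener–Hopf compactification of $Q$ means that $Q$ is a closed subsemigroup of the additive topological group $V$ (which is locally compact, Hausdorff and second countable) with $0\in Q$, $\Omega$ dense in $Q$ and $Q-Q=V$; that $X$ is compact Hausdorff with an injective action of $Q$; and that, with $$A_u:=\{g\in V:\ g=a-b \text{ and } u\boxplus a=v\boxplus b \text{ for some } a,b\in Q,\ v\in X\}\qquad(u\in X),$$ the following hold: (C1) for every $a\in Q$ the set $\{u\boxplus(b+a):b\in\Omega,\ u\in X\}$ is open in $X$; (C2) there is $u_0\in X$ such that $A_{u_0}=Q$ and $\{u_0\boxplus a:a\in Q\}$ is dense in $X$; (C3) for $u,v\in X$, if $A_u=A_v$ then $u=v$. -/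

import Mathlib

open Set Topology

/-! ### Wiener-Hopf compactifications of subsemigroups

The ambient group `G` is written additively (it need not be commutative), so a product `a b⁻¹`
becomes `a - b`. -/

section WienerHopf

variable {G : Type*} [AddGroup G] [TopologicalSpace G]

/-- `G` is a locally compact, Hausdorff, second countable topological group and `P` is a closed
subsemigroup of `G` containing the identity which is solid (its interior is dense in it) and
right Ore (`P P⁻¹ = G`). -/
structure IsSolidOreSemigroup (P : Set G) : Prop where
  isTopologicalAddGroup : IsTopologicalAddGroup G
  locallyCompactSpace : LocallyCompactSpace G
  t2Space : T2Space G
  secondCountableTopology : SecondCountableTopology G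
  zero_mem : (0 : G) ∈ P
  add_mem : ∀ a ∈ P, ∀ b ∈ P, a + b ∈ P
  isClosed : IsClosed P
  solid : P ⊆ closure (interior P)
  ore : ∀ g : G, ∃ a ∈ P, ∃ b ∈ P, g = a - b

/-- `τ x a` (written `x a` on paper) is a continuous right action of the semigroup `P` on `X`,
the identity of `P` acts trivially, and every element of `P` acts injectively. -/
structure IsInjectiveAction {P : Set G} {X : Type*} [TopologicalSpace X] (τ : X → P → X) :
    Prop where
  continuous : Continuous (fun p : X × P => τ p.1 p.2)
  act_add : ∀ (x : X) (a b c : P), (c : G) = a + b → τ x c = τ (τ x a) b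
  act_zero : ∀ (x : X) (o : P), (o : G) = 0 → τ x o = x
  injective : ∀ a : P, Function.Injective (fun x => τ x a)

/-- The set `A_x` of all `g = a b⁻¹` with `a, b ∈ P` and `x a = y b` for some `y ∈ X`. -/
def translationSet {P : Set G} {X : Type*} (τ : X → P → X) (x : X) : Set G :=
  {g | ∃ (a b : P) (y : X), g = (a : G) - (b : G) ∧ τ x a = τ y b}

/-- `X`, with the action `τ` of `P`, is the Wiener-Hopf compactification of `P`. -/
structure IsWienerHopfCompactification {P : Set G} {X : Type*} [TopologicalSpace X]
    (τ : X → P → X) : Prop where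
  semigroup : IsSolidOreSemigroup P
  compactSpace : CompactSpace X
  t2Space : T2Space X
  action : IsInjectiveAction τ
  /-- (C1): the set of all `x (b a)` with `x ∈ X` and `b ∈ Int(P)` is open. -/
  c1 : ∀ a : P, IsOpen {z : X | ∃ (x : X) (b c : P),
    (b : G) ∈ interior P ∧ (c : G) = b + a ∧ z = τ x c}
  /-- (C2): some point has `A_{x₀} = P` and a dense orbit. -/
  c2 : ∃ x₀ : X, translationSet τ x₀ = P ∧ Dense (range (τ x₀))
  /-- (C3): the sets `A_x` separate the points of `X`. -/
  c3 : ∀ x y : X, translationSet τ x = translationSet τ y → x = y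

end WienerHopf

/-! ### Jordan algebras -/

section Jordan

variable {V : Type*} [NonAssocCommRing V] [Module ℝ V] [IsScalarTower ℝ V V] [SMulCommClass ℝ V V]

/-- A real algebra is Euclidean if it carries an inner product for which every multiplication
operator `L(x)` is symmetric. -/
class IsEuclideanAlgebra (V : Type*) [NonAssocCommRing V] [Module ℝ V] : Prop where
  exists_inner : ∃ B : LinearMap.BilinForm ℝ V, (∀ x y, B x y = B y x) ∧ (∀ x, x ≠ 0 → 0 < B x x) ∧
    ∀ x y z, B (x * y) z = B y (x * z)

/-- `P(x, y) = L(x) L(y) + L(y) L(x) - L(x y)`. -/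
noncomputable def jordanP₂ (x y : V) : Module.End ℝ V :=
  LinearMap.mulLeft ℝ x * LinearMap.mulLeft ℝ y + LinearMap.mulLeft ℝ y * LinearMap.mulLeft ℝ x
    - LinearMap.mulLeft ℝ (x * y)

/-- The quadratic representation `P(x) = P(x, x)`. -/
noncomputable def jordanP (x : V) : Module.End ℝ V := jordanP₂ x x

/-- `y` is an inverse of `x` in the Jordan algebra: `x y = 1` and `y` lies in `ℝ[x]`, the
subalgebra generated by `1` and `x`. -/
def IsJordanInverse (x y : V) : Prop :=
  y ∈ NonUnitalAlgebra.adjoin ℝ ({1, x} : Set V) ∧ x * y = 1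

/-- Invertible elements of a Jordan algebra. -/
def IsJordanInvertible (x : V) : Prop := ∃ y, IsJordanInverse x y

open Classical in
/-- The inverse of an invertible element of a Jordan algebra (`0` if `x` is not invertible). The
inverse is unique since `ℝ[x]` is associative. -/
noncomputable def jordanInv (x : V) : V :=
  if h : IsJordanInvertible x then h.choose else 0

/-- The cone `Q` of squares. -/
def squareCone (V : Type*) [Mul V] : Set V := {q | ∃ x : V, q = x * x}

/-- The order `x ≤ y` of the cone of squares. -/
def JordanLE (x y : V) : Prop := y - x ∈ squareCone V

/-- The order interval `{u : -1 ≤ u ≤ 1}`. -/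
def orderInterval (V : Type*) [NonAssocCommRing V] : Set V :=
  {u | JordanLE (-1) u ∧ JordanLE u 1}

/-- `ũ = (1 - u) / 2`. -/
noncomputable def jordanTilde (u : V) : V := (2⁻¹ : ℝ) • (1 - u)

/-- `u ⊞ a = 1 - 2 ũ + 2 P(ũ) (ũ + a⁻¹)⁻¹`. -/
noncomputable def boxplus (u a : V) : V :=
  1 - (2 : ℝ) • jordanTilde u
    + (2 : ℝ) • jordanP (jordanTilde u) (jordanInv (jordanTilde u + jordanInv a))

/-- The map `τ : X × Q → X`, with `X` the order interval and `Q` the cone of squares, is given by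
`u ⊞ a` for all `u` in `X` and all `a` in the interior of `Q`. -/
def ExtendsBoxplus [TopologicalSpace V] (τ : orderInterval V → squareCone V → orderInterval V) :
    Prop :=
  ∀ (u : orderInterval V) (a : squareCone V), (a : V) ∈ interior (squareCone V) →
    (τ u a : V) = boxplus (u : V) (a : V)

end Jordan

/-! Put t = (1 - u)/2, so that X becomes the interval 0 ≤ t ≤ 1. Hua's identity gives t - P(t)(t +
a⁻¹)⁻¹ = (t⁻¹ + a)⁻¹ for positive invertible t and a, so the action is translation by a in the
coordinate t⁻¹. For singular t this coordinate is replaced by the expression P(√t)(1 + P(√t)a)⁻¹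
(`parSum`), which is jointly continuous and makes sense for every a in V with 1 + P(√t)a positive
and invertible (`ParDom`). Identities are proved for t + ε and passed to the limit ε → 0. Since a
need not be positive, acting by -a undoes acting by a; this gives injectivity.

The conditions are read off in the same coordinate. The set A_u consists of the g for which `parSum
t g` is defined and at most 1; for invertible t this means t⁻¹ + g ≥ 1. At t = 1 it is Q, and the
orbit {(1 + a)⁻¹} contains every invertible t in the interval (C2). The points in (C1) are those
where acting by -a is possible and leads strictly below 1, an open condition. For (C3), 1 - (t +
ε)⁻¹ lies in A_u; if it lies in A_v as well, the coordinate of v is at most t + ε.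

The Jordan theory behind this is the spectral theorem, the Peirce decomposition, self-duality of Q,
and two facts for positive invertible s and y: P(s)y is positive and invertible, and (P(s)y)⁻¹ =
P(s⁻¹)y⁻¹. In place of the fundamental formula for P, a flow is used: with s = exp x, the curve Y(τ)
= P(exp τx)y satisfies Y' = 2xY and (Y⁻¹)' = -2xY⁻¹, so P(exp τx)Y(τ)⁻¹ is constant
(`IsIdempotentFrame.frameExp_flow`). -/

set_option linter.unusedSectionVars false

/-! ### Consequences of the linearized Jordan identity -/

section JordanIdentities

variable {V : Type*} [NonAssocCommRing V] [Module ℝ V] [IsCommJordan V]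

/-- The fully linearized Jordan identity. -/
theorem jordan_linearized (a b c d : V) :
    a * ((b * c) * d) + b * ((c * a) * d) + c * ((a * b) * d)
      = (b * c) * (a * d) + (c * a) * (b * d) + (a * b) * (c * d) := by
  have h : (2 : ℕ) • ((a * ((b * c) * d) - (b * c) * (a * d)) + (b * ((c * a) * d)
      - (c * a) * (b * d)) + (c * ((a * b) * d) - (a * b) * (c * d))) = 0 :=
    DFunLike.congr_fun (two_nsmul_lie_lmul_lmul_add_add_eq_zero a b c) d
  rw [two_nsmul, ← two_smul ℝ, smul_eq_zero] at h
  have h' := h.resolve_left two_ne_zero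
  rw [← sub_eq_zero, ← h']
  abel

/-- The linearized identity with two equal arguments, solved for L(x²y). It yields the recursion for
L(xⁿ) and, for idempotent x, the Peirce relations. -/
theorem sq_mul_mul (x y z : V) :
    ((x * x) * y) * z
      = (x * x) * (y * z) + (2 : ℝ) • ((x * y) * (x * z)) - (2 : ℝ) • (x * (y * (x * z))) := by
  have h := jordan_linearized z x x y
  rw [mul_comm z ((x * x) * y), mul_comm z x, mul_comm z y, mul_comm (x * z) y,
    mul_comm (x * z) (x * y)] at h
  rw [two_smul, two_smul, ← sub_eq_zero]
  rw [← sub_eq_zero] at h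
  rw [← h]
  abel

theorem mul_comm_of_mul_eq_zero {c d : V} (h : c * d = 0) (hd : d * d = d) (z : V) :
    c * (d * z) = d * (c * z) := by
  have h := jordan_linearized c d d z
  simpa [hd, mul_comm d c, ‹c * d = 0›] using h

end JordanIdentities

/-! ### Power associativity -/

section Polynomial

open Polynomial

variable {V : Type*} [NonAssocCommRing V] [Module ℝ V] [IsScalarTower ℝ V V] [SMulCommClass ℝ V V]

/-- The value `p(x)` of a polynomial at an element of a power associative algebra. -/
noncomputable def polyAt (x : V) (p : ℝ[X]) : V := aeval (LinearMap.mulLeft ℝ x) p 1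

theorem polyAt_mem_adjoin (x : V) (p : ℝ[X]) :
    polyAt x p ∈ NonUnitalAlgebra.adjoin ℝ ({1, x} : Set V) := by
  have hx : x ∈ NonUnitalAlgebra.adjoin ℝ ({1, x} : Set V) :=
    NonUnitalAlgebra.subset_adjoin ℝ (by simp)
  have h1 : (1 : V) ∈ NonUnitalAlgebra.adjoin ℝ ({1, x} : Set V) :=
    NonUnitalAlgebra.subset_adjoin ℝ (by simp)
  have hpow : ∀ n : ℕ, ((LinearMap.mulLeft ℝ x) ^ n) 1 ∈
      NonUnitalAlgebra.adjoin ℝ ({1, x} : Set V) := by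
    intro n
    induction n with
    | zero => simpa using h1
    | succ n ih =>
      rw [pow_succ', Module.End.mul_apply, LinearMap.mulLeft_apply]
      exact mul_mem hx ih
  unfold polyAt
  induction p using Polynomial.induction_on' with
  | add p q hp hq => rw [map_add, LinearMap.add_apply]; exact add_mem hp hq
  | monomial n a =>
    rw [aeval_monomial, ← Algebra.smul_def, LinearMap.smul_apply]
    exact SMulMemClass.smul_mem a (hpow n)

variable [IsCommJordan V]

omit [IsScalarTower ℝ V V] in
/-- Left multiplication by a power of `x` lies in the commutative algebra generated by `L(x)` and
`L(x²)`; in particular it commutes with `L(x)`. -/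
theorem commute_mulLeft_pow (x : V) (n : ℕ) :
    Commute (LinearMap.mulLeft ℝ (((LinearMap.mulLeft ℝ x) ^ n) 1)) (LinearMap.mulLeft ℝ x) := by
  set L := LinearMap.mulLeft ℝ x with hL
  have h2 : Commute (LinearMap.mulLeft ℝ (x * x)) L := by
    refine LinearMap.ext fun z => ?_
    simpa [hL] using IsJordan.lmul_lmul_comm_lmul x z
  induction n using Nat.strong_induction_on with
  | _ n ih =>
    match n with
    | 0 =>
      refine LinearMap.ext fun z => ?_
      simp
    | 1 =>
      rw [pow_one]
      simp [hL]
    | n + 2 =>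
      have e0 := ih n (by omega)
      have e1 := ih (n + 1) (by omega)
      have hmul : (L ^ (n + 2)) 1 = (x * x) * (L ^ n) 1 := by
        have : (x * x) * (L ^ n) 1 = (LinearMap.mulLeft ℝ (x * x) * L ^ n) 1 := rfl
        rw [this, (h2.pow_right n).eq, pow_add, Module.End.mul_apply, Module.End.mul_apply]
        simp [hL, pow_two]
      have hs : x * (L ^ n) 1 = (L ^ (n + 1)) 1 := by
        rw [pow_succ', Module.End.mul_apply]; rfl
      -- `sq_mul_mul` with y = xⁿ writes L(xⁿ⁺²) through operators already known to commute with
      -- L(x).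
      have hrec : LinearMap.mulLeft ℝ ((L ^ (n + 2)) 1)
          = LinearMap.mulLeft ℝ (x * x) * LinearMap.mulLeft ℝ ((L ^ n) 1)
            + (2 : ℝ) • (LinearMap.mulLeft ℝ ((L ^ (n + 1)) 1) * L)
            - (2 : ℝ) • (L * (LinearMap.mulLeft ℝ ((L ^ n) 1) * L)) := by
        refine LinearMap.ext fun z => ?_
        rw [hmul]
        simp only [LinearMap.mulLeft_apply, LinearMap.sub_apply, LinearMap.add_apply,
          LinearMap.smul_apply, Module.End.mul_apply]
        rw [sq_mul_mul, hs]
        simp [hL]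
      rw [hrec]
      refine Commute.sub_left (Commute.add_left (h2.mul_left e0) ?_) ?_
      · exact (e1.mul_left (Commute.refl L)).smul_left _
      · exact ((Commute.refl L).mul_left (e0.mul_left (Commute.refl L))).smul_left _

theorem commute_mulLeft_polyAt (x : V) (p : ℝ[X]) :
    Commute (LinearMap.mulLeft ℝ (polyAt x p)) (LinearMap.mulLeft ℝ x) := by
  unfold polyAt
  have key : ∀ y : V, LinearMap.mulLeft ℝ y = LinearMap.mul ℝ V y := fun y => rfl
  induction p using Polynomial.induction_on' with
  | add p q hp hq =>
    rw [map_add, LinearMap.add_apply, key, map_add]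
    exact hp.add_left hq
  | monomial n a =>
    rw [aeval_monomial, ← Algebra.smul_def, LinearMap.smul_apply, key, map_smul]
    exact (commute_mulLeft_pow x n).smul_left a

/-- L(p(x)) commutes with L(x), hence with q(L(x)); apply both orders to 1. -/
theorem polyAt_mul (x : V) (p q : ℝ[X]) : polyAt x (p * q) = polyAt x p * polyAt x q := by
  have hc : Commute (LinearMap.mulLeft ℝ (polyAt x p)) (aeval (LinearMap.mulLeft ℝ x) q) :=
    Algebra.commute_of_mem_adjoin_singleton_of_commute
      (aeval_mem_adjoin_singleton ℝ _) (commute_mulLeft_polyAt x p)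
  have h1 : polyAt x p * polyAt x q
      = (LinearMap.mulLeft ℝ (polyAt x p) * aeval (LinearMap.mulLeft ℝ x) q) 1 := rfl
  rw [h1, hc.eq, mul_comm p q, polyAt, map_mul, Module.End.mul_apply, Module.End.mul_apply]
  simp [polyAt]

end Polynomial

/-! ### Diagonalization of symmetric operators -/

section Symmetric

variable {V : Type*} [AddCommGroup V] [Module ℝ V] [FiniteDimensional ℝ V]

theorem iSup_eigenspace_eq_top_of_isSymm (B : LinearMap.BilinForm ℝ V)
    (hB : ∀ x y, B x y = B y x) (hpos : ∀ x, x ≠ 0 → 0 < B x x) (T : Module.End ℝ V)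
    (hT : ∀ x y, B (T x) y = B x (T y)) : ⨆ μ : ℝ, Module.End.eigenspace T μ = ⊤ := by
  have hnn : ∀ x, 0 ≤ B x x := fun x => by
    rcases eq_or_ne x 0 with rfl | h
    · simp
    · exact (hpos x h).le
  let cd : InnerProductSpace.Core ℝ V :=
    { inner := fun x y => B x y
      conj_inner_symm := fun x y => by simp [hB x y]
      re_inner_nonneg := fun x => by simpa using hnn x
      add_left := fun x y z => by simp
      smul_left := fun x y r => by simp
      definite := fun x hx => by
        by_contra h
        exact (hpos x h).ne' hx }
  let _ : NormedAddCommGroup V := cd.toNormedAddCommGroup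
  let _ : InnerProductSpace ℝ V := InnerProductSpace.ofCore cd.toCore
  have hs : LinearMap.IsSymmetric T := fun x y => hT x y
  exact Submodule.orthogonal_eq_bot_iff.mp hs.orthogonalComplement_iSup_eigenspaces_eq_bot

end Symmetric

/-! ### Calculus in a system of orthogonal idempotents -/

section Frames

variable {V : Type*} [NonAssocCommRing V] [Module ℝ V]

/-- A complete system of nonzero orthogonal idempotents. -/
structure IsIdempotentFrame {ι : Type*} [Fintype ι] (c : ι → V) : Prop where
  idem : ∀ i, c i * c i = c i
  orth : ∀ i j, i ≠ j → c i * c j = 0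
  ne_zero : ∀ i, c i ≠ 0
  sum_eq_one : ∑ i, c i = 1

/-- The linear combination `∑ fᵢ cᵢ`. -/
noncomputable def frameSum {ι : Type*} [Fintype ι] (c : ι → V) (f : ι → ℝ) : V := ∑ i, f i • c i

variable {ι : Type*} [Fintype ι] {c : ι → V}

theorem frameSum_add (c : ι → V) (f g : ι → ℝ) :
    frameSum c f + frameSum c g = frameSum c (fun i => f i + g i) := by
  simp [frameSum, add_smul, Finset.sum_add_distrib]

theorem frameSum_sub (c : ι → V) (f g : ι → ℝ) :
    frameSum c f - frameSum c g = frameSum c (fun i => f i - g i) := by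
  simp [frameSum, sub_smul, Finset.sum_sub_distrib]

theorem frameSum_smul (c : ι → V) (r : ℝ) (f : ι → ℝ) :
    r • frameSum c f = frameSum c (fun i => r * f i) := by
  simp [frameSum, mul_smul, Finset.smul_sum]

theorem IsIdempotentFrame.frameSum_one (hc : IsIdempotentFrame c) :
    frameSum c (fun _ => 1) = 1 := by
  simp [frameSum, hc.sum_eq_one]

theorem IsIdempotentFrame.frameSum_const (hc : IsIdempotentFrame c) (r : ℝ) :
    frameSum c (fun _ => r) = r • (1 : V) := by
  rw [← hc.frameSum_one, frameSum_smul]; simp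

variable [IsScalarTower ℝ V V] [SMulCommClass ℝ V V]

theorem IsIdempotentFrame.mul_frameSum (hc : IsIdempotentFrame c) (i : ι) (f : ι → ℝ) :
    c i * frameSum c f = f i • c i := by
  classical
  rw [frameSum, Finset.mul_sum, Finset.sum_eq_single i]
  · rw [mul_smul_comm, hc.idem]
  · intro j _ hj
    rw [mul_smul_comm, hc.orth i j hj.symm, smul_zero]
  · simp

theorem IsIdempotentFrame.frameSum_mul (hc : IsIdempotentFrame c) (f g : ι → ℝ) :
    frameSum c f * frameSum c g = frameSum c (fun i => f i * g i) := by
  change (∑ i, f i • c i) * frameSum c g = ∑ i, (f i * g i) • c i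
  rw [Finset.sum_mul]
  refine Finset.sum_congr rfl fun i _ => ?_
  rw [smul_mul_assoc, hc.mul_frameSum, smul_smul]

theorem IsIdempotentFrame.frameSum_injective (hc : IsIdempotentFrame c) {f g : ι → ℝ}
    (h : frameSum c f = frameSum c g) : f = g := by
  funext i
  have := hc.mul_frameSum i f
  rw [h, hc.mul_frameSum] at this
  exact (smul_left_injective ℝ (hc.ne_zero i) this).symm

open Polynomial in
theorem IsIdempotentFrame.polyAt_frameSum (hc : IsIdempotentFrame c) (l : ι → ℝ) (p : ℝ[X]) :
    polyAt (frameSum c l) p = frameSum c (fun i => p.eval (l i)) := by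
  rw [polyAt, ← hc.sum_eq_one, map_sum]
  change _ = ∑ i, p.eval (l i) • c i
  refine Finset.sum_congr rfl fun i _ => ?_
  refine Module.End.aeval_apply_of_mem_apply_eq_smul ?_
  rw [LinearMap.mulLeft_apply, mul_comm, hc.mul_frameSum]

open Polynomial in
theorem exists_polynomial_eval_eq (s : Finset ℝ) (f : ℝ → ℝ) :
    ∃ p : ℝ[X], ∀ x ∈ s, p.eval x = f x :=
  ⟨Lagrange.interpolate s id f, fun x hx => by
    simpa using Lagrange.eval_interpolate_at_node (v := id) f (Function.injective_id.injOn) hx⟩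

/-- On the finite set of coefficients every function f agrees with an interpolating polynomial. -/
theorem IsIdempotentFrame.frameSum_mem_adjoin (hc : IsIdempotentFrame c) (l : ι → ℝ) (f : ℝ → ℝ) :
    frameSum c (fun i => f (l i)) ∈ NonUnitalAlgebra.adjoin ℝ ({1, frameSum c l} : Set V) := by
  classical
  obtain ⟨p, hp⟩ := exists_polynomial_eval_eq (Finset.univ.image l) f
  have : frameSum c (fun i => f (l i)) = polyAt (frameSum c l) p := by
    rw [hc.polyAt_frameSum]
    congr 1; funext i
    exact (hp _ (by simp)).symm
  rw [this]
  exact polyAt_mem_adjoin _ _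

/-- Makes functional calculus independent of the frame: one polynomial interpolates f on both sets
of coefficients, and its value at the element does not refer to a frame. -/
theorem IsIdempotentFrame.frameSum_comp_eq (hc : IsIdempotentFrame c)
    {κ : Type*} [Fintype κ] {d : κ → V} (hd : IsIdempotentFrame d) {l : ι → ℝ} {m : κ → ℝ}
    (h : frameSum c l = frameSum d m) (f : ℝ → ℝ) :
    frameSum c (fun i => f (l i)) = frameSum d (fun i => f (m i)) := by
  classical
  obtain ⟨p, hp⟩ := exists_polynomial_eval_eq (Finset.univ.image l ∪ Finset.univ.image m) f
  have h1 := hc.polyAt_frameSum l p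
  rw [h, hd.polyAt_frameSum] at h1
  have e1 : (fun i => f (l i)) = fun i => p.eval (l i) :=
    funext fun i => (hp _ (by simp)).symm
  have e2 : (fun i => f (m i)) = fun i => p.eval (m i) :=
    funext fun i => (hp _ (by simp)).symm
  rw [e1, e2, h1]

theorem IsIdempotentFrame.isJordanInverse_iff (hc : IsIdempotentFrame c) (l : ι → ℝ) (y : V) :
    IsJordanInverse (frameSum c l) y ↔ (∀ i, l i ≠ 0) ∧ y = frameSum c (fun i => (l i)⁻¹) := by
  constructor
  · rintro ⟨hy, hxy⟩
    -- The span of the frame is a subalgebra containing 1 and the element, so an inverse has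
    -- coordinates and must be the coordinatewise one.
    have hspan : ∀ z ∈ NonUnitalAlgebra.adjoin ℝ ({1, frameSum c l} : Set V),
        ∃ f, z = frameSum c f := by
      intro z hz
      induction hz using NonUnitalAlgebra.adjoin_induction with
      | mem z hz =>
        rcases hz with rfl | rfl
        · exact ⟨_, hc.frameSum_one.symm⟩
        · exact ⟨_, rfl⟩
      | add x y _ _ hx hy =>
        obtain ⟨f, rfl⟩ := hx
        obtain ⟨g, rfl⟩ := hy
        exact ⟨_, frameSum_add c f g⟩
      | zero => exact ⟨fun _ => 0, by simp [frameSum]⟩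
      | mul x y _ _ hx hy =>
        obtain ⟨f, rfl⟩ := hx
        obtain ⟨g, rfl⟩ := hy
        exact ⟨_, hc.frameSum_mul f g⟩
      | smul r x _ hx =>
        obtain ⟨f, rfl⟩ := hx
        exact ⟨_, frameSum_smul c r f⟩
    obtain ⟨f, rfl⟩ := hspan y hy
    rw [hc.frameSum_mul, ← hc.frameSum_one] at hxy
    have h1 := hc.frameSum_injective hxy
    have h2 : ∀ i, l i * f i = 1 := fun i => congrFun h1 i
    refine ⟨fun i => left_ne_zero_of_mul_eq_one (h2 i), ?_⟩
    congr 1; funext i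
    exact eq_inv_of_mul_eq_one_right (h2 i)
  · rintro ⟨hl, rfl⟩
    refine ⟨hc.frameSum_mem_adjoin l fun r => r⁻¹, ?_⟩
    rw [hc.frameSum_mul, ← hc.frameSum_one]
    congr 1; funext i
    exact mul_inv_cancel₀ (hl i)

theorem IsIdempotentFrame.isJordanInvertible (hc : IsIdempotentFrame c) {l : ι → ℝ}
    (hl : ∀ i, l i ≠ 0) : IsJordanInvertible (frameSum c l) :=
  ⟨_, (hc.isJordanInverse_iff l _).2 ⟨hl, rfl⟩⟩

theorem IsIdempotentFrame.jordanInv_frameSum (hc : IsIdempotentFrame c) {l : ι → ℝ}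
    (hl : ∀ i, l i ≠ 0) : jordanInv (frameSum c l) = frameSum c (fun i => (l i)⁻¹) := by
  have h := hc.isJordanInvertible hl
  rw [jordanInv, dif_pos h]
  exact ((hc.isJordanInverse_iff l _).1 h.choose_spec).2

end Frames

/-! ### Peirce decomposition -/

section Peirce

variable {V : Type*} [NonAssocCommRing V] [Module ℝ V] [IsScalarTower ℝ V V] [SMulCommClass ℝ V V]

theorem jordanP₂_apply (x y v : V) : jordanP₂ x y v = x * (y * v) + y * (x * v) - (x * y) * v := rfl

theorem jordanP_apply (x v : V) : jordanP x v = (2 : ℝ) • (x * (x * v)) - (x * x) * v := by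
  rw [jordanP, jordanP₂_apply, two_smul]

theorem jordanP_one (v : V) : jordanP 1 v = v := by
  rw [jordanP_apply]; simp only [one_mul]; module

theorem jordanP_apply_one (x : V) : jordanP x 1 = x * x := by
  rw [jordanP_apply]; simp only [mul_one]; module

theorem jordanP_smul (r : ℝ) (x v : V) : jordanP (r • x) v = r ^ 2 • jordanP x v := by
  simp only [jordanP_apply, smul_mul_assoc, mul_smul_comm]; module

theorem jordanP_one_add_smul (r : ℝ) (x v : V) :
    jordanP (1 + r • x) v = v + (2 * r) • (x * v) + r ^ 2 • jordanP x v := by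
  simp only [jordanP_apply, add_mul, mul_add, one_mul, mul_one, smul_mul_assoc, mul_smul_comm]
  module

variable [IsCommJordan V]

omit [SMulCommClass ℝ V V] [IsScalarTower ℝ V V] in
-- T = L(e) satisfies 2T³ - 3T² + T = 0, so its only possible eigenvalues are 0, 1/2 and 1.
theorem idem_mul_mul {e : V} (he : e * e = e) (z : V) :
    (2 : ℝ) • (e * (e * (e * z))) = (3 : ℝ) • (e * (e * z)) - e * z := by
  have h := sq_mul_mul e e z
  simp only [he] at h
  rw [eq_sub_iff_add_eq, eq_comm, ← sub_eq_zero] at h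
  rw [← sub_eq_zero, ← neg_eq_zero, ← h]
  module

omit [SMulCommClass ℝ V V] [IsScalarTower ℝ V V] in
theorem idem_mul_mul_orth {e d : V} (he : e * e = e) (hed : e * d = 0) (z : V) :
    (2 : ℝ) • (e * (d * (e * z))) = e * (d * z) := by
  have h := sq_mul_mul e d z
  simp only [he, hed, zero_mul, smul_zero, add_zero] at h
  exact (sub_eq_zero.1 h.symm).symm

/-- Polarization: `idem_mul_mul_orth` for the idempotent e + d, minus its instances for e and for d,
leaves only the mixed term. Thus no joint eigenvector has nonzero eigenvalues for three orthogonal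
idempotents. -/
theorem idem_mul_mul_mul_orth {e d g : V} (he : e * e = e) (hd : d * d = d)
    (hed : e * d = 0) (heg : e * g = 0) (hdg : d * g = 0) (z : V) :
    e * (d * (g * z)) = 0 := by
  have h1 : (e + d) * (e + d) = e + d := by
    simp [mul_add, add_mul, he, hd, hed, mul_comm d e]
  have h2 : (e + d) * g = 0 := by simp [add_mul, heg, hdg]
  have h := idem_mul_mul_orth h1 h2 z
  have h3 := idem_mul_mul_orth he heg z
  have h4 := idem_mul_mul_orth hd hdg z
  simp only [add_mul, mul_add, smul_add] at h
  rw [h3, h4, mul_comm_of_mul_eq_zero (mul_comm g e ▸ heg) he z,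
    mul_comm_of_mul_eq_zero (mul_comm g d ▸ hdg) hd z,
    mul_comm_of_mul_eq_zero (mul_comm d e ▸ hed) he (g * z)] at h
  have h5 : (4 : ℝ) • (e * (d * (g * z))) = 0 := by
    rw [← sub_eq_zero] at h
    rw [← h]
    module
  exact (smul_eq_zero.1 h5).resolve_left (by norm_num)

variable {ι : Type*} [Fintype ι] {c : ι → V}

theorem IsIdempotentFrame.mul_left_comm (hc : IsIdempotentFrame c) (i j : ι) (z : V) :
    c i * (c j * z) = c j * (c i * z) := by
  rcases eq_or_ne i j with rfl | h
  · rfl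
  · exact mul_comm_of_mul_eq_zero (hc.orth i j h) (hc.idem j) z

/-- P(cᵢ, cⱼ) takes values in the Peirce space Vᵢⱼ. The cases according to which of i, j, k coincide
each reduce to one of the three preceding relations. -/
theorem IsIdempotentFrame.mul_jordanP₂ [DecidableEq ι] (hc : IsIdempotentFrame c) (i j k : ι)
    (v : V) : c k * jordanP₂ (c i) (c j) v
      = (((Pi.single i 1 : ι → ℝ) k + (Pi.single j 1 : ι → ℝ) k) / 2) • jordanP₂ (c i) (c j) v := by
  rw [jordanP₂_apply]
  rcases eq_or_ne i j with rfl | hij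
  · rw [hc.idem]
    rcases eq_or_ne k i with rfl | hki
    · have := idem_mul_mul (hc.idem k) v
      rw [Pi.single_eq_same]
      simp only [mul_add, mul_sub]
      rw [← two_smul ℝ (c k * (c k * (c k * v))), this]
      module
    · rw [Pi.single_eq_of_ne hki]
      simp only [mul_add, mul_sub]
      have := idem_mul_mul_orth (hc.idem i) (hc.orth i k hki.symm) v
      rw [← two_smul ℝ (c k * (c i * (c i * v))), hc.mul_left_comm k i (c i * v), this,
        hc.mul_left_comm k i]
      module
  · rw [hc.orth i j hij, zero_mul, sub_zero, hc.mul_left_comm j i]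
    rcases eq_or_ne k i with rfl | hki
    · have := idem_mul_mul_orth (hc.idem k) (hc.orth k j hij) v
      rw [Pi.single_eq_same, Pi.single_eq_of_ne hij, mul_add, ← two_smul ℝ (c k * _),
        hc.mul_left_comm k j v, this, ← hc.mul_left_comm k j]
      module
    · rcases eq_or_ne k j with rfl | hkj
      · have := idem_mul_mul_orth (hc.idem k) (hc.orth k i hki) v
        rw [Pi.single_eq_same, Pi.single_eq_of_ne hki, mul_add, ← two_smul ℝ (c k * _),
          this, hc.mul_left_comm k i]
        module
      · rw [Pi.single_eq_of_ne hki, Pi.single_eq_of_ne hkj, mul_add,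
          idem_mul_mul_mul_orth (hc.idem k) (hc.idem i) (hc.orth k i hki)
            (hc.orth k j hkj) (hc.orth i j hij)]
        module

/-- Peirce decomposition: linear maps agree as soon as they agree on simultaneous eigenvectors
of the `L(cₖ)`, which have eigenvalues `(δₖᵢ + δₖⱼ) / 2`. -/
theorem IsIdempotentFrame.linearMap_ext (hc : IsIdempotentFrame c) {S T : Module.End ℝ V}
    (h : ∀ (v : V) (i j : ι), (∀ f : ι → ℝ, frameSum c f * v = ((f i + f j) / 2) • v) →
      S v = T v) : S = T := by
  classical
  -- Bilinearity: the sum over all ordered pairs is P(1, 1), the identity.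
  have hsum : ∀ v : V, v = ∑ i, ∑ j, jordanP₂ (c i) (c j) v := by
    intro v
    simp only [jordanP₂_apply, Finset.sum_add_distrib, Finset.sum_sub_distrib]
    simp only [← Finset.sum_mul, ← Finset.mul_sum, hc.sum_eq_one]
    simp
  refine LinearMap.ext fun v => ?_
  rw [hsum v, map_sum, map_sum]
  refine Finset.sum_congr rfl fun i _ => ?_
  rw [map_sum, map_sum]
  refine Finset.sum_congr rfl fun j _ => ?_
  refine h _ i j fun f => ?_
  rw [frameSum, Finset.sum_mul]
  simp only [smul_mul_assoc, hc.mul_jordanP₂, smul_smul]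
  rw [← Finset.sum_smul]
  congr 1
  simp only [mul_div_assoc', mul_add]
  rw [← Finset.sum_div, Finset.sum_add_distrib]
  simp [Pi.single_apply]

/-- On Vᵢⱼ the eigenvalue is 2((fᵢ + fⱼ)/2)² - (fᵢ² + fⱼ²)/2 = fᵢfⱼ. -/
theorem IsIdempotentFrame.jordanP_apply_peirce (hc : IsIdempotentFrame c) {v : V} {i j : ι}
    (hv : ∀ f : ι → ℝ, frameSum c f * v = ((f i + f j) / 2) • v) (f : ι → ℝ) :
    jordanP (frameSum c f) v = (f i * f j) • v := by
  rw [jordanP_apply, hc.frameSum_mul, hv, hv, mul_smul_comm, hv]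
  module

theorem IsIdempotentFrame.jordanP_jordanP (hc : IsIdempotentFrame c) (f g : ι → ℝ) (v : V) :
    jordanP (frameSum c f) (jordanP (frameSum c g) v)
      = jordanP (frameSum c (fun i => f i * g i)) v := by
  have : jordanP (frameSum c f) * jordanP (frameSum c g)
      = jordanP (frameSum c (fun i => f i * g i)) := by
    refine hc.linearMap_ext fun v i j hv => ?_
    rw [Module.End.mul_apply, hc.jordanP_apply_peirce hv, map_smul, hc.jordanP_apply_peirce hv,
      hc.jordanP_apply_peirce hv]
    module
  exact DFunLike.congr_fun this v

/-- The operator identity P(x⁻¹)L(x) = L(x⁻¹), checked on each Vᵢⱼ. It later turns the derivative of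
the inverse along the flow into a multiplication. -/
theorem IsIdempotentFrame.jordanP_inv_mul (hc : IsIdempotentFrame c) {f : ι → ℝ}
    (hf : ∀ i, f i ≠ 0) (v : V) :
    jordanP (frameSum c (fun i => (f i)⁻¹)) (frameSum c f * v)
      = frameSum c (fun i => (f i)⁻¹) * v := by
  have : jordanP (frameSum c (fun i => (f i)⁻¹)) * LinearMap.mulLeft ℝ (frameSum c f)
      = LinearMap.mulLeft ℝ (frameSum c (fun i => (f i)⁻¹)) := by
    refine hc.linearMap_ext fun v i j hv => ?_
    simp only [Module.End.mul_apply, LinearMap.mulLeft_apply]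
    rw [hv, hv, map_smul, hc.jordanP_apply_peirce hv, smul_smul]
    congr 1
    have := hf i
    have := hf j
    field_simp
    ring
  exact DFunLike.congr_fun this v

theorem IsIdempotentFrame.jordanP_mul_self (hc : IsIdempotentFrame c) (f g : ι → ℝ) :
    jordanP (frameSum c f) (frameSum c g) = frameSum c (fun i => f i * f i * g i) := by
  rw [jordanP_apply]
  simp only [hc.frameSum_mul]
  rw [frameSum_smul, frameSum_sub]
  congr 1; funext i; ring

end Peirce

/-! ### Spectral theorem, self-dual cone, inverses -/

section Euclidean

variable {V : Type*} [NonAssocCommRing V] [Module ℝ V]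

/-- An inner product for which all multiplication operators are symmetric. -/
structure IsEuclideanForm (B : LinearMap.BilinForm ℝ V) : Prop where
  symm : ∀ x y, B x y = B y x
  pos : ∀ x, x ≠ 0 → 0 < B x x
  assoc : ∀ x y z, B (x * y) z = B y (x * z)

theorem IsEuclideanForm.nonneg {B : LinearMap.BilinForm ℝ V} (hB : IsEuclideanForm B) (x : V) :
    0 ≤ B x x := by
  rcases eq_or_ne x 0 with rfl | h
  · simp
  · exact (hB.pos x h).le

theorem exists_isEuclideanForm (V : Type*) [NonAssocCommRing V] [Module ℝ V]
    [IsEuclideanAlgebra V] : ∃ B : LinearMap.BilinForm ℝ V, IsEuclideanForm B :=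
  let ⟨B, h1, h2, h3⟩ := IsEuclideanAlgebra.exists_inner (V := V)
  ⟨B, h1, h2, h3⟩

variable [IsScalarTower ℝ V V] [SMulCommClass ℝ V V] [IsCommJordan V]

open Polynomial in
/-- The spectral theorem. -/
theorem exists_frameSum_eq [IsEuclideanAlgebra V] [FiniteDimensional ℝ V] (x : V) :
    ∃ (S : Finset ℝ) (c : S → V), IsIdempotentFrame c ∧ frameSum c (fun μ => (μ : ℝ)) = x := by
  classical
  obtain ⟨B, hB⟩ := exists_isEuclideanForm V
  have htop := iSup_eigenspace_eq_top_of_isSymm B hB.symm hB.pos (LinearMap.mulLeft ℝ x)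
    fun y z => hB.assoc x y z
  -- The frame is found by splitting 1 into eigenvectors of L(x); its nonzero components are the
  -- idempotents.
  have h1 : (1 : V) ∈ ⨆ μ : ℝ, Module.End.eigenspace (LinearMap.mulLeft ℝ x) μ := by
    rw [htop]; trivial
  rw [Submodule.mem_iSup_iff_exists_finsupp] at h1
  obtain ⟨e, he, hsum⟩ := h1
  have hmul : ∀ μ, x * e μ = μ • e μ := fun μ => Module.End.mem_eigenspace_iff.1 (he μ)
  have hone : ∑ μ : e.support, e μ = 1 := by
    rw [← hsum, Finsupp.sum]
    exact Finset.sum_coe_sort e.support fun i => e i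
  have hpoly : ∀ p : ℝ[X], polyAt x p = ∑ μ : e.support, p.eval (μ : ℝ) • e μ := by
    intro p
    rw [polyAt, ← hone, map_sum]
    refine Finset.sum_congr rfl fun μ _ => ?_
    exact Module.End.aeval_apply_of_mem_apply_eq_smul (hmul μ)
  -- The component at μ is the value at x of the Lagrange polynomial of μ, so `polyAt_mul` computes
  -- products of components.
  let p : ℝ → ℝ[X] := fun μ => Lagrange.basis e.support id μ
  have hp1 : ∀ μ ∈ e.support, (p μ).eval μ = 1 := fun μ hμ =>
    Lagrange.eval_basis_self (v := id) Function.injective_id.injOn hμ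
  have hp0 : ∀ μ ν, μ ≠ ν → ν ∈ e.support → (p μ).eval ν = 0 := fun μ ν hμν hν =>
    Lagrange.eval_basis_of_ne (v := id) hμν hν
  have hpe : ∀ μ : e.support, polyAt x (p μ) = e μ := by
    intro μ
    rw [hpoly, Finset.sum_eq_single μ, hp1 _ μ.2, one_smul]
    · intro ν _ hν
      rw [hp0 _ _ (fun h => hν (Subtype.ext h.symm)) ν.2, zero_smul]
    · simp
  have hprod : ∀ μ ν : e.support, e μ * e ν = (p μ).eval (ν : ℝ) • e ν := by
    intro μ ν
    rw [← hpe μ, ← hpe ν, ← polyAt_mul, hpoly, Finset.sum_eq_single ν, eval_mul, hp1 _ ν.2, mul_one,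
      hpe]
    · intro κ _ hκ
      rw [eval_mul, hp0 _ _ (fun h => hκ (Subtype.ext h.symm)) κ.2, mul_zero, zero_smul]
    · simp
  refine ⟨e.support, fun μ => e μ, ⟨fun μ => ?_, fun μ ν h => ?_, fun μ => ?_, hone⟩, ?_⟩
  · rw [hprod, hp1 _ μ.2, one_smul]
  · rw [hprod, hp0 _ _ (fun h' => h (Subtype.ext h')) ν.2, zero_smul]
  · exact Finsupp.mem_support_iff.1 μ.2
  · have := hpoly X
    simp only [polyAt, aeval_X, LinearMap.mulLeft_apply, mul_one, eval_X] at this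
    exact this.symm

variable {B : LinearMap.BilinForm ℝ V}

/-- By its cubic equation, T = L(e) equals T² + 4(T - T²)², a sum of squares of symmetric operators.
-/
theorem IsEuclideanForm.mul_idem_nonneg (hB : IsEuclideanForm B) {e : V} (he : e * e = e) (v : V) :
    0 ≤ B (e * v) v := by
  have h := idem_mul_mul he v
  have h' := idem_mul_mul he (e * v)
  have key : e * v = e * (e * v)
      + (4 : ℝ) • (e * (e * v) - (2 : ℝ) • (e * (e * (e * v))) + e * (e * (e * (e * v)))) := by
    rw [h]
    have h2 : e * (e * (e * (e * v))) = (2⁻¹ : ℝ) • ((3 : ℝ) • (e * (e * (e * v)))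
        - e * (e * v)) := by
      rw [← h', smul_smul]; norm_num
    have h3 : e * (e * (e * v)) = (2⁻¹ : ℝ) • ((3 : ℝ) • (e * (e * v)) - e * v) := by
      rw [← h, smul_smul]; norm_num
    rw [h2, h3]
    module
  have e1 : B (e * (e * v)) v = B (e * v) (e * v) := hB.assoc _ _ _
  have e2 : B (e * (e * v) - (2 : ℝ) • (e * (e * (e * v))) + e * (e * (e * (e * v)))) v
      = B (e * v - e * (e * v)) (e * v - e * (e * v)) := by
    simp only [map_add, map_sub, map_smul, LinearMap.add_apply, LinearMap.sub_apply,
      LinearMap.smul_apply, smul_eq_mul]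
    simp only [hB.assoc]
    ring
  rw [key, map_add, map_smul, LinearMap.add_apply, LinearMap.smul_apply, e1, e2, smul_eq_mul]
  have := hB.nonneg (e * v)
  have := hB.nonneg (e * v - e * (e * v))
  positivity

variable {ι : Type*} [Fintype ι] {c : ι → V}

theorem IsEuclideanForm.frameSum_idem (hB : IsEuclideanForm B) (hc : IsIdempotentFrame c)
    (l : ι → ℝ) (i : ι) : B (frameSum c l) (c i * c i) = l i * B (c i) (c i) := by
  rw [← hB.assoc, hc.mul_frameSum]
  simp

theorem IsIdempotentFrame.frameSum_mem_squareCone (hc : IsIdempotentFrame c) {l : ι → ℝ}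
    (hl : ∀ i, 0 ≤ l i) : frameSum c l ∈ squareCone V := by
  refine ⟨frameSum c (fun i => √(l i)), ?_⟩
  rw [hc.frameSum_mul]
  congr 1; funext i
  exact (Real.mul_self_sqrt (hl i)).symm

variable [IsEuclideanAlgebra V] [FiniteDimensional ℝ V]

/-- The cone of squares is self-dual. -/
theorem IsEuclideanForm.mem_squareCone_iff (hB : IsEuclideanForm B) (x : V) :
    x ∈ squareCone V ↔ ∀ y, 0 ≤ B x (y * y) := by
  constructor
  · rintro ⟨z, rfl⟩ y
    -- With z = ∑ λᵢcᵢ, the pairing of z² with y² is ∑ λᵢ² B(cᵢy, y). Conversely, testing against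
    -- the squares cᵢ² isolates the coefficients of x.
    obtain ⟨S, c, hc, rfl⟩ := exists_frameSum_eq z
    rw [hc.frameSum_mul, frameSum, map_sum, LinearMap.sum_apply]
    refine Finset.sum_nonneg fun i _ => ?_
    rw [map_smul, LinearMap.smul_apply, smul_eq_mul, hB.symm, hB.assoc, hB.symm, mul_comm]
    exact mul_nonneg (mul_comm y (c i) ▸ hB.mul_idem_nonneg (hc.idem i) y) (mul_self_nonneg _)
  · intro h
    obtain ⟨S, c, hc, rfl⟩ := exists_frameSum_eq x
    refine hc.frameSum_mem_squareCone fun i => ?_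
    have h1 := h (c i)
    rw [hB.frameSum_idem hc] at h1
    exact nonneg_of_mul_nonneg_left h1 (hB.pos _ (hc.ne_zero i))

theorem IsEuclideanForm.squareCone_nonneg (hB : IsEuclideanForm B) {x y : V}
    (hx : x ∈ squareCone V) (hy : y ∈ squareCone V) : 0 ≤ B x y := by
  obtain ⟨z, rfl⟩ := hy
  exact (hB.mem_squareCone_iff x).1 hx z

theorem IsIdempotentFrame.frameSum_mem_squareCone_iff (hc : IsIdempotentFrame c) {l : ι → ℝ} :
    frameSum c l ∈ squareCone V ↔ ∀ i, 0 ≤ l i := by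
  obtain ⟨B, hB⟩ := exists_isEuclideanForm V
  refine ⟨fun h i => ?_, hc.frameSum_mem_squareCone⟩
  have h1 := (hB.mem_squareCone_iff _).1 h (c i)
  rw [hB.frameSum_idem hc] at h1
  exact nonneg_of_mul_nonneg_left h1 (hB.pos _ (hc.ne_zero i))

theorem squareCone_add {x y : V} (hx : x ∈ squareCone V) (hy : y ∈ squareCone V) :
    x + y ∈ squareCone V := by
  obtain ⟨B, hB⟩ := exists_isEuclideanForm V
  rw [hB.mem_squareCone_iff] at *
  intro z
  rw [map_add, LinearMap.add_apply]
  exact add_nonneg (hx z) (hy z)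

theorem squareCone_smul {x : V} (hx : x ∈ squareCone V) {r : ℝ} (hr : 0 ≤ r) :
    r • x ∈ squareCone V := by
  obtain ⟨y, rfl⟩ := hx
  refine ⟨√r • y, ?_⟩
  rw [smul_mul_assoc, mul_smul_comm, smul_smul, Real.mul_self_sqrt hr]

theorem zero_mem_squareCone : (0 : V) ∈ squareCone V := ⟨0, by simp⟩

theorem one_mem_squareCone : (1 : V) ∈ squareCone V := ⟨1, by simp⟩

theorem eq_zero_of_mem_squareCone_of_neg_mem {x : V} (hx : x ∈ squareCone V)
    (hx' : -x ∈ squareCone V) : x = 0 := by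
  obtain ⟨S, c, hc, rfl⟩ := exists_frameSum_eq x
  have h : -frameSum c (fun μ : S => (μ : ℝ)) = frameSum c (fun μ : S => (-1 : ℝ) * μ) := by
    rw [← frameSum_smul]; simp
  rw [h] at hx'
  rw [hc.frameSum_mem_squareCone_iff] at hx hx'
  have : (fun μ : S => (μ : ℝ)) = fun _ => 0 := funext fun i => by
    have := hx i
    have := hx' i
    linarith
  rw [this]
  simp [frameSum]

theorem exists_smul_one_sub_mem (x : V) :
    ∃ K : ℝ, 0 ≤ K ∧ ∀ r, K ≤ r → r • (1 : V) - x ∈ squareCone V := by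
  obtain ⟨S, c, hc, rfl⟩ := exists_frameSum_eq x
  refine ⟨∑ i : S, |(i : ℝ)|, by positivity, fun r hr => ?_⟩
  rw [← hc.frameSum_const, frameSum_sub, hc.frameSum_mem_squareCone_iff]
  intro i
  have h1 : |(i : ℝ)| ≤ ∑ i : S, |(i : ℝ)| :=
    Finset.single_le_sum (f := fun i : S => |(i : ℝ)|) (fun _ _ => abs_nonneg _) (Finset.mem_univ i)
  have := le_abs_self (i : ℝ)
  linarith

/-- Functional calculus. -/
noncomputable def jordanFun (f : ℝ → ℝ) (x : V) : V :=
  frameSum (exists_frameSum_eq x).choose_spec.choose (fun μ => f μ)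

theorem IsIdempotentFrame.jordanFun_frameSum (hc : IsIdempotentFrame c) (f : ℝ → ℝ) (l : ι → ℝ) :
    jordanFun f (frameSum c l) = frameSum c (fun i => f (l i)) := by
  obtain ⟨h1, h2⟩ := (exists_frameSum_eq (frameSum c l)).choose_spec.choose_spec
  exact h1.frameSum_comp_eq hc h2 f

/-- The square root on the cone of squares. -/
noncomputable def jordanSqrt (x : V) : V := jordanFun Real.sqrt x

theorem IsIdempotentFrame.jordanSqrt_frameSum (hc : IsIdempotentFrame c) (l : ι → ℝ) :
    jordanSqrt (frameSum c l) = frameSum c (fun i => √(l i)) := hc.jordanFun_frameSum _ _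

theorem jordanSqrt_mem (x : V) : jordanSqrt x ∈ squareCone V := by
  obtain ⟨S, c, hc, rfl⟩ := exists_frameSum_eq x
  rw [hc.jordanSqrt_frameSum]
  exact hc.frameSum_mem_squareCone fun i => Real.sqrt_nonneg _

theorem jordanSqrt_mul_self {x : V} (hx : x ∈ squareCone V) :
    jordanSqrt x * jordanSqrt x = x := by
  obtain ⟨S, c, hc, rfl⟩ := exists_frameSum_eq x
  rw [hc.frameSum_mem_squareCone_iff] at hx
  rw [hc.jordanSqrt_frameSum, hc.frameSum_mul]
  congr 1; funext i
  exact Real.mul_self_sqrt (hx i)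

theorem jordanSqrt_sq {s : V} (hs : s ∈ squareCone V) : jordanSqrt (s * s) = s := by
  obtain ⟨S, c, hc, rfl⟩ := exists_frameSum_eq s
  rw [hc.frameSum_mem_squareCone_iff] at hs
  rw [hc.frameSum_mul, hc.jordanSqrt_frameSum]
  congr 1; funext i
  exact Real.sqrt_mul_self (hs i)

/-- The elements `x ≥ δ · 1` with `δ > 0`, i.e. the positive elements with positive spectrum. -/
def posCone (V : Type*) [NonAssocCommRing V] [Module ℝ V] : Set V :=
  {x | ∃ δ : ℝ, 0 < δ ∧ x - δ • (1 : V) ∈ squareCone V}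

theorem IsIdempotentFrame.frameSum_mem_posCone_iff (hc : IsIdempotentFrame c) {l : ι → ℝ} :
    frameSum c l ∈ posCone V ↔ ∀ i, 0 < l i := by
  constructor
  · rintro ⟨δ, hδ, h⟩ i
    rw [← hc.frameSum_const, frameSum_sub, hc.frameSum_mem_squareCone_iff] at h
    have := h i
    linarith
  · intro h
    rcases isEmpty_or_nonempty ι with hι | hι
    · refine ⟨1, one_pos, ?_⟩
      rw [← hc.frameSum_const, frameSum_sub, hc.frameSum_mem_squareCone_iff]
      exact fun i => (IsEmpty.false i).elim
    · obtain ⟨i₀, hi₀⟩ := Finite.exists_min l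
      refine ⟨l i₀, h i₀, ?_⟩
      rw [← hc.frameSum_const, frameSum_sub, hc.frameSum_mem_squareCone_iff]
      intro i
      have := hi₀ i
      linarith

theorem posCone_subset {x : V} (hx : x ∈ posCone V) : x ∈ squareCone V := by
  obtain ⟨δ, hδ, h⟩ := hx
  have := squareCone_add h (squareCone_smul one_mem_squareCone hδ.le)
  rwa [sub_add_cancel] at this

theorem posCone_add {x y : V} (hx : x ∈ posCone V) (hy : y ∈ squareCone V) :
    x + y ∈ posCone V := by
  obtain ⟨δ, hδ, h⟩ := hx
  refine ⟨δ, hδ, ?_⟩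
  have := squareCone_add h hy
  rwa [sub_add_eq_add_sub] at this

theorem posCone_of_sub_mem {x y : V} (hx : x ∈ posCone V) (hy : y - x ∈ squareCone V) :
    y ∈ posCone V := by
  have := posCone_add hx hy
  rwa [add_sub_cancel] at this

theorem posCone_smul {x : V} (hx : x ∈ posCone V) {r : ℝ} (hr : 0 < r) : r • x ∈ posCone V := by
  obtain ⟨δ, hδ, h⟩ := hx
  refine ⟨r * δ, by positivity, ?_⟩
  rw [mul_smul, ← smul_sub]
  exact squareCone_smul h hr.le

theorem one_mem_posCone : (1 : V) ∈ posCone V := ⟨1, one_pos, by simpa using zero_mem_squareCone⟩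

theorem jordanSqrt_mem_posCone {x : V} (hx : x ∈ posCone V) : jordanSqrt x ∈ posCone V := by
  obtain ⟨S, c, hc, rfl⟩ := exists_frameSum_eq x
  rw [hc.jordanSqrt_frameSum]
  rw [hc.frameSum_mem_posCone_iff] at hx ⊢
  exact fun i => Real.sqrt_pos.2 (hx i)

theorem isJordanInvertible_of_mem_posCone {x : V} (hx : x ∈ posCone V) :
    IsJordanInvertible x := by
  obtain ⟨S, c, hc, rfl⟩ := exists_frameSum_eq x
  rw [hc.frameSum_mem_posCone_iff] at hx
  exact hc.isJordanInvertible fun i => (hx i).ne'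

theorem jordanInv_mem_posCone {x : V} (hx : x ∈ posCone V) : jordanInv x ∈ posCone V := by
  obtain ⟨S, c, hc, rfl⟩ := exists_frameSum_eq x
  have h := hc.frameSum_mem_posCone_iff.1 hx
  rw [hc.jordanInv_frameSum fun i => (h i).ne', hc.frameSum_mem_posCone_iff]
  exact fun i => inv_pos.2 (h i)

theorem jordanInv_jordanInv {x : V} (hx : x ∈ posCone V) : jordanInv (jordanInv x) = x := by
  obtain ⟨S, c, hc, rfl⟩ := exists_frameSum_eq x
  have h := hc.frameSum_mem_posCone_iff.1 hx
  rw [hc.jordanInv_frameSum fun i => (h i).ne',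
    hc.jordanInv_frameSum fun i => (inv_pos.2 (h i)).ne']
  simp

theorem jordanInv_one : jordanInv (1 : V) = 1 := by
  obtain ⟨S, c, hc, h⟩ := exists_frameSum_eq (1 : V)
  conv_lhs => rw [← hc.frameSum_one]
  rw [hc.jordanInv_frameSum fun i => one_ne_zero]
  simp [hc.frameSum_one]

theorem mul_jordanInv {x : V} (hx : x ∈ posCone V) : x * jordanInv x = 1 := by
  obtain ⟨S, c, hc, rfl⟩ := exists_frameSum_eq x
  have h := hc.frameSum_mem_posCone_iff.1 hx
  rw [hc.jordanInv_frameSum fun i => (h i).ne', hc.frameSum_mul, ← hc.frameSum_one]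
  congr 1; funext i
  exact mul_inv_cancel₀ (h i).ne'

theorem jordanInv_mul_self {x : V} (hx : x ∈ posCone V) :
    jordanInv x * jordanInv x = jordanInv (x * x) := by
  obtain ⟨S, c, hc, rfl⟩ := exists_frameSum_eq x
  have h := hc.frameSum_mem_posCone_iff.1 hx
  rw [hc.jordanInv_frameSum fun i => (h i).ne', hc.frameSum_mul, hc.frameSum_mul,
    hc.jordanInv_frameSum fun i => (mul_pos (h i) (h i)).ne']
  simp only [mul_inv]

theorem jordanP_jordanInv_self {x : V} (hx : x ∈ posCone V) : jordanP x (jordanInv x) = x := by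
  obtain ⟨S, c, hc, rfl⟩ := exists_frameSum_eq x
  have h := hc.frameSum_mem_posCone_iff.1 hx
  rw [hc.jordanInv_frameSum fun i => (h i).ne', hc.jordanP_mul_self]
  congr 1; funext i
  have := (h i).ne'
  field_simp

theorem jordanP_jordanInv_apply {x : V} (hx : x ∈ posCone V) (v : V) :
    jordanP (jordanInv x) (jordanP x v) = v := by
  obtain ⟨S, c, hc, rfl⟩ := exists_frameSum_eq x
  have h := hc.frameSum_mem_posCone_iff.1 hx
  rw [hc.jordanInv_frameSum fun i => (h i).ne', hc.jordanP_jordanP]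
  conv_rhs => rw [← jordanP_one v, ← hc.frameSum_one]
  congr 3; funext i
  exact inv_mul_cancel₀ (h i).ne'

theorem jordanP_apply_jordanInv {x : V} (hx : x ∈ posCone V) (v : V) :
    jordanP x (jordanP (jordanInv x) v) = v := by
  have := jordanP_jordanInv_apply (jordanInv_mem_posCone hx) v
  rwa [jordanInv_jordanInv hx] at this

theorem jordanP_jordanInv_mul {x : V} (hx : x ∈ posCone V) (v : V) :
    jordanP (jordanInv x) (x * v) = jordanInv x * v := by
  obtain ⟨S, c, hc, rfl⟩ := exists_frameSum_eq x
  have h := hc.frameSum_mem_posCone_iff.1 hx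
  rw [hc.jordanInv_frameSum fun i => (h i).ne', hc.jordanP_inv_mul fun i => (h i).ne']

theorem jordanP_sq (x v : V) : jordanP (x * x) v = jordanP x (jordanP x v) := by
  obtain ⟨S, c, hc, rfl⟩ := exists_frameSum_eq x
  rw [hc.jordanP_jordanP, hc.frameSum_mul]

/-- The equation `P(x) w = x` characterizes the inverse. -/
theorem eq_jordanInv_of_jordanP {x w : V} (hx : x ∈ posCone V) (h : jordanP x w = x) :
    w = jordanInv x := by
  rw [← jordanP_jordanInv_apply hx w, h]
  have := jordanP_jordanInv_self (jordanInv_mem_posCone hx)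
  rwa [jordanInv_jordanInv hx] at this

/-- For `y` close to an invertible `x`, the difference of the inverses. -/
theorem jordanInv_sub_jordanInv {x y : V} (hx : x ∈ posCone V) (hy : y ∈ posCone V) :
    jordanInv y - jordanInv x
      = -jordanP (jordanInv y) ((y - x) + jordanP (y - x) (jordanInv x)) := by
  set w := jordanInv x with hw
  have key : jordanP y (jordanInv y - w) = -((y - x) + jordanP (y - x) w) := by
    rw [map_sub, jordanP_jordanInv_self hy]
    have hxw : x * w = 1 := mul_jordanInv hx
    have hPx : jordanP x w = x := jordanP_jordanInv_self hx
    have hcomm : x * (w * (y - x)) = w * (x * (y - x)) := by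
      obtain ⟨S, c, hc, rfl⟩ := exists_frameSum_eq x
      have h := hc.frameSum_mem_posCone_iff.1 hx
      rw [hw, hc.jordanInv_frameSum fun i => (h i).ne']
      have : LinearMap.mulLeft ℝ (frameSum c fun i : S => (i : ℝ))
            * LinearMap.mulLeft ℝ (frameSum c fun i : S => (i : ℝ)⁻¹)
          = LinearMap.mulLeft ℝ (frameSum c fun i : S => (i : ℝ)⁻¹)
            * LinearMap.mulLeft ℝ (frameSum c fun i : S => (i : ℝ)) := by
        refine hc.linearMap_ext fun v i j hv => ?_
        simp only [Module.End.mul_apply, LinearMap.mulLeft_apply]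
        rw [hv, hv, mul_smul_comm, mul_smul_comm, hv, hv, smul_comm]
      exact DFunLike.congr_fun this _
    obtain ⟨h, rfl⟩ : ∃ h, y = x + h := ⟨y - x, by abel⟩
    rw [add_sub_cancel_left] at *
    -- The mixed term 2P(x, h)w collapses to 2h because xw = 1 and L(x), L(w) commute.
    have hexp : jordanP (x + h) w = jordanP x w + (2 : ℝ) • h + jordanP h w := by
      rw [jordanP_apply, jordanP_apply, jordanP_apply]
      simp only [add_mul, mul_add, hxw, mul_one]
      rw [mul_comm h w, hcomm, mul_comm h x, mul_comm w (x * h)]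
      module
    rw [hexp, hPx]
    module
  rw [← map_neg, ← key, jordanP_jordanInv_apply hy]

end Euclidean

/-! ### Compactness of balls of the inner product -/

section Compact

variable {V : Type*} [AddCommGroup V] [Module ℝ V] [FiniteDimensional ℝ V]
  [TopologicalSpace V] [IsTopologicalAddGroup V] [ContinuousSMul ℝ V] [T2Space V]

theorem continuous_bilin (B : LinearMap.BilinForm ℝ V) : Continuous fun p : V × V => B p.1 p.2 := by
  let b := Module.finBasis ℝ V
  have h : (fun p : V × V => B p.1 p.2) = fun p => ∑ i, b.coord i p.1 * B (b i) p.2 := by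
    funext p
    conv_lhs => rw [← b.sum_repr p.1]
    simp only [map_sum, map_smul, LinearMap.sum_apply, LinearMap.smul_apply, smul_eq_mul,
      Module.Basis.coord_apply]
  rw [h]
  refine continuous_finsetSum _ fun i _ => ?_
  exact ((b.coord i).continuous_of_finiteDimensional.comp continuous_fst).mul
    ((B (b i)).continuous_of_finiteDimensional.comp continuous_snd)

/-- The topology of V is not given by B. An orthogonal basis bounds the coordinates by B x x, and a
box of coordinates has compact image. -/
theorem isCompact_setOf_bilin_le (B : LinearMap.BilinForm ℝ V) (hB : ∀ x y, B x y = B y x)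
    (hpos : ∀ x, x ≠ 0 → 0 < B x x) (C : ℝ) : IsCompact {x | B x x ≤ C} := by
  have hnn : ∀ x, 0 ≤ B x x := fun x => by
    rcases eq_or_ne x 0 with rfl | h
    · simp
    · exact (hpos x h).le
  obtain ⟨v, hv⟩ := LinearMap.BilinForm.exists_orthogonal_basis (B := B) ⟨fun x y => hB x y⟩
  have hvpos : ∀ i, 0 < B (v i) (v i) := fun i => hpos _ (v.ne_zero i)
  have hcoord : ∀ x i, B x (v i) = v.repr x i * B (v i) (v i) := by
    intro x i
    conv_lhs => rw [← v.sum_repr x]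
    rw [map_sum, LinearMap.sum_apply, Finset.sum_eq_single i]
    · rw [map_smul, LinearMap.smul_apply, smul_eq_mul]
    · intro j _ hj
      have : B (v j) (v i) = 0 := hv hj
      rw [map_smul, LinearMap.smul_apply, this, smul_zero]
    · exact fun h => (h (Finset.mem_univ i)).elim
  have hle : ∀ x i, (v.repr x i) ^ 2 * B (v i) (v i) ≤ B x x := by
    intro x i
    have h := hnn (x - v.repr x i • v i)
    simp only [map_sub, map_smul, LinearMap.sub_apply, LinearMap.smul_apply, smul_eq_mul] at h
    rw [hB (v i) x, hcoord x i] at h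
    nlinarith
  let K : Set (Fin (Module.finrank ℝ V) → ℝ) :=
    Set.pi univ fun i => Icc (-√(C / B (v i) (v i))) (√(C / B (v i) (v i)))
  have hK : IsCompact K := isCompact_univ_pi fun i => isCompact_Icc
  have hcont : Continuous v.equivFun.symm :=
    LinearMap.continuous_of_finiteDimensional
      (v.equivFun.symm : (Fin (Module.finrank ℝ V) → ℝ) →ₗ[ℝ] V)
  refine (hK.image hcont).of_isClosed_subset ?_ ?_
  · exact isClosed_le ((continuous_bilin B).comp (continuous_id.prodMk continuous_id))
      continuous_const
  · intro x hx
    refine ⟨v.equivFun x, ?_, v.equivFun.symm_apply_apply x⟩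
    intro i _
    have h1 : (v.repr x i) ^ 2 ≤ C / B (v i) (v i) :=
      (le_div_iff₀ (hvpos i)).2 ((hle x i).trans hx)
    exact abs_le.1 (Real.abs_le_sqrt h1)

end Compact

/-! ### Topology of the cone; continuity of root and inverse -/

section ConeTopology

variable {V : Type*} [NonAssocCommRing V] [Module ℝ V] [IsScalarTower ℝ V V] [SMulCommClass ℝ V V]
  [FiniteDimensional ℝ V] [TopologicalSpace V] [IsTopologicalAddGroup V] [ContinuousSMul ℝ V]
  [T2Space V]

theorem continuousMul_of_finiteDimensional : ContinuousMul V := by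
  refine ⟨?_⟩
  let b := Module.finBasis ℝ V
  have h : (fun p : V × V => p.1 * p.2) = fun p => ∑ i, b.coord i p.1 • (b i * p.2) := by
    funext p
    conv_lhs => rw [← b.sum_repr p.1]
    rw [Finset.sum_mul]
    simp only [smul_mul_assoc, Module.Basis.coord_apply]
  rw [h]
  refine continuous_finsetSum _ fun i _ => ?_
  exact ((b.coord i).continuous_of_finiteDimensional.comp continuous_fst).smul
    ((LinearMap.mulLeft ℝ (b i)).continuous_of_finiteDimensional.comp continuous_snd)

theorem continuous_jordanP : Continuous fun p : V × V => jordanP p.1 p.2 := by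
  have := continuousMul_of_finiteDimensional (V := V)
  simp only [jordanP_apply]
  fun_prop

theorem tendsto_jordanP {α : Type*} {l : Filter α} {f g : α → V} {x y : V}
    (hf : Filter.Tendsto f l (𝓝 x)) (hg : Filter.Tendsto g l (𝓝 y)) :
    Filter.Tendsto (fun a => jordanP (f a) (g a)) l (𝓝 (jordanP x y)) := by
  have h := continuous_jordanP.tendsto (x, y)
  exact Filter.Tendsto.comp (f := fun a => (f a, g a)) h (hf.prodMk_nhds hg)

theorem continuous_jordanP_comp {α : Type*} [TopologicalSpace α] {f g : α → V}
    (hf : Continuous f) (hg : Continuous g) : Continuous fun a => jordanP (f a) (g a) :=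
  continuous_iff_continuousAt.2 fun a => tendsto_jordanP (hf.tendsto a) (hg.tendsto a)

variable [IsCommJordan V] [IsEuclideanAlgebra V]

theorem isClosed_squareCone : IsClosed (squareCone V) := by
  obtain ⟨B, hB⟩ := exists_isEuclideanForm V
  have : squareCone V = ⋂ y : V, {x | 0 ≤ B x (y * y)} := by
    ext x
    rw [mem_iInter]
    exact hB.mem_squareCone_iff x
  rw [this]
  refine isClosed_iInter fun y => isClosed_le continuous_const ?_
  exact (continuous_bilin B).comp (continuous_id.prodMk continuous_const)

/-- Each ± basis vector is dominated by a multiple of 1, so vectors with small coordinates are at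
least -ε · 1. -/
theorem setOf_add_smul_one_mem_nhds_zero {ε : ℝ} (hε : 0 < ε) :
    {v : V | v + ε • (1 : V) ∈ squareCone V} ∈ 𝓝 (0 : V) := by
  let b := Module.finBasis ℝ V
  have hK : ∀ i, ∃ K : ℝ, 0 ≤ K ∧ K • (1 : V) + b i ∈ squareCone V ∧
      K • (1 : V) - b i ∈ squareCone V := by
    intro i
    obtain ⟨K₁, h1, h1'⟩ := exists_smul_one_sub_mem (b i)
    obtain ⟨K₂, h2, h2'⟩ := exists_smul_one_sub_mem (-b i)
    refine ⟨max K₁ K₂, le_max_of_le_left h1, ?_, h1' _ (le_max_left _ _)⟩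
    have := h2' _ (le_max_right K₁ K₂)
    rwa [sub_neg_eq_add] at this
  choose K hK0 hKp hKm using hK
  have hterm : ∀ (r : ℝ) i, (|r| * K i) • (1 : V) + r • b i ∈ squareCone V := by
    intro r i
    rcases le_total 0 r with hr | hr
    · rw [abs_of_nonneg hr]
      have := squareCone_smul (hKp i) hr
      rwa [smul_add, smul_smul] at this
    · rw [abs_of_nonpos hr]
      have := squareCone_smul (hKm i) (neg_nonneg.2 hr)
      rwa [smul_sub, smul_smul, neg_smul r (b i), sub_neg_eq_add] at this
  have hcont : Continuous fun v : V => ∑ i, |b.coord i v| * K i :=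
    continuous_finsetSum _ fun i _ =>
      ((b.coord i).continuous_of_finiteDimensional.abs).mul continuous_const
  have h0 : ∀ᶠ v in 𝓝 (0 : V), ∑ i, |b.coord i v| * K i < ε := by
    refine (hcont.tendsto 0).eventually_lt_const ?_
    simpa using hε
  filter_upwards [h0] with v hv
  have hsum : (∑ i, |b.coord i v| * K i) • (1 : V) + v ∈ squareCone V := by
    conv in (_ + v) => rw [← b.sum_repr v, Finset.sum_smul, ← Finset.sum_add_distrib]
    refine Finset.sum_induction _ (· ∈ squareCone V) (fun _ _ => squareCone_add)
      zero_mem_squareCone fun i _ => ?_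
    rw [b.sum_repr]
    exact hterm _ i
  have := squareCone_add hsum (squareCone_smul one_mem_squareCone (sub_nonneg.2 hv.le))
  convert this using 1
  module

theorem isOpen_posCone : IsOpen (posCone V) := by
  rw [isOpen_iff_mem_nhds]
  rintro x ⟨δ, hδ, h⟩
  have h1 : Filter.Tendsto (fun y : V => y - x) (𝓝 x) (𝓝 0) :=
    tendsto_sub_nhds_zero_iff.2 Filter.tendsto_id
  filter_upwards [h1 (setOf_add_smul_one_mem_nhds_zero (half_pos hδ))] with y hy
  refine ⟨δ / 2, half_pos hδ, ?_⟩
  have := squareCone_add h hy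
  convert this using 1
  module

theorem interior_squareCone : interior (squareCone V) = posCone V := by
  refine Subset.antisymm ?_ (interior_maximal (fun _ => posCone_subset) isOpen_posCone)
  intro x hx
  have h1 : Filter.Tendsto (fun r : ℝ => x - r • (1 : V)) (𝓝[>] 0) (𝓝 x) := by
    have h : Continuous fun r : ℝ => x - r • (1 : V) := by fun_prop
    have h0 := h.tendsto 0
    rw [zero_smul, sub_zero] at h0
    exact h0.mono_left nhdsWithin_le_nhds
  have h2 := h1.eventually (mem_interior_iff_mem_nhds.1 hx)
  obtain ⟨r, hr, hr0⟩ := (h2.and self_mem_nhdsWithin).exists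
  exact ⟨r, hr0, hr⟩

/-- Order intervals are compact. -/
theorem isCompact_squareCone_Icc (z : V) :
    IsCompact {x : V | x ∈ squareCone V ∧ z - x ∈ squareCone V} := by
  obtain ⟨B, hB⟩ := exists_isEuclideanForm V
  refine (isCompact_setOf_bilin_le B hB.symm hB.pos (B z z)).of_isClosed_subset ?_ ?_
  · exact isClosed_squareCone.inter
      (isClosed_squareCone.preimage (continuous_const.sub continuous_id))
  · rintro x ⟨hx, hzx⟩
    -- B(x, z) ≥ B(x, x) together with B(z - x, z - x) ≥ 0 gives B(x, x) ≤ B(z, z).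
    have h1 := hB.squareCone_nonneg hx hzx
    have h2 := hB.squareCone_nonneg hzx hzx
    simp only [map_sub, LinearMap.sub_apply, hB.symm z x] at h1 h2
    simp only [mem_ofPred_eq]
    linarith

theorem eventually_smul_one_sub_mem (x : V) :
    ∃ K : ℝ, 0 < K ∧ ∀ᶠ y in 𝓝 x, K • (1 : V) - y ∈ squareCone V := by
  obtain ⟨K, hK, h⟩ := exists_smul_one_sub_mem x
  refine ⟨K + 1, by linarith, ?_⟩
  have h1 : Filter.Tendsto (fun y : V => x - y) (𝓝 x) (𝓝 0) := by
    have h : Continuous fun y : V => x - y := by fun_prop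
    simpa using h.tendsto x
  filter_upwards [h1 (setOf_add_smul_one_mem_nhds_zero one_pos)] with y hy
  have := squareCone_add (h K le_rfl) hy
  convert this using 1
  module

theorem smul_one_sub_jordanSqrt_mem {t : V} (ht : t ∈ squareCone V) {K : ℝ}
    (h : K • (1 : V) - t ∈ squareCone V) : √K • (1 : V) - jordanSqrt t ∈ squareCone V := by
  obtain ⟨S, c, hc, rfl⟩ := exists_frameSum_eq t
  rw [← hc.frameSum_const, frameSum_sub, hc.frameSum_mem_squareCone_iff] at h
  rw [hc.jordanSqrt_frameSum, ← hc.frameSum_const, frameSum_sub, hc.frameSum_mem_squareCone_iff]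
  intro i
  exact sub_nonneg.2 (Real.sqrt_le_sqrt (sub_nonneg.1 (h i)))

theorem inv_smul_one_sub_jordanInv_mem {x : V} {δ : ℝ} (hδ : 0 < δ)
    (h : x - δ • (1 : V) ∈ squareCone V) : δ⁻¹ • (1 : V) - jordanInv x ∈ squareCone V := by
  obtain ⟨S, c, hc, rfl⟩ := exists_frameSum_eq x
  rw [← hc.frameSum_const, frameSum_sub, hc.frameSum_mem_squareCone_iff] at h
  have h' : ∀ i : S, δ ≤ i := fun i => sub_nonneg.1 (h i)
  rw [hc.jordanInv_frameSum fun i => (hδ.trans_le (h' i)).ne', ← hc.frameSum_const, frameSum_sub,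
    hc.frameSum_mem_squareCone_iff]
  intro i
  exact sub_nonneg.2 (inv_anti₀ hδ (h' i))

/-- Near t the roots stay in a compact order interval. Any ultrafilter limit s of them is positive
with s² = t, hence is √t by uniqueness of the positive root. -/
theorem continuousOn_jordanSqrt : ContinuousOn (jordanSqrt (V := V)) (squareCone V) := by
  have := continuousMul_of_finiteDimensional (V := V)
  intro t ht
  obtain ⟨K, hK, hev⟩ := eventually_smul_one_sub_mem t
  refine (Filter.tendsto_iff_ultrafilter _ _ _).2 fun U hU => ?_
  have hUt : Filter.Tendsto id (U : Filter V) (𝓝 t) := hU.trans nhdsWithin_le_nhds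
  have hQ : ∀ᶠ y in (U : Filter V), y ∈ squareCone V := hU self_mem_nhdsWithin
  have hcpt := isCompact_squareCone_Icc (√K • (1 : V))
  have hmem : ∀ᶠ y in (U : Filter V), jordanSqrt y ∈
      {x : V | x ∈ squareCone V ∧ √K • (1 : V) - x ∈ squareCone V} := by
    filter_upwards [hQ, hUt hev] with y hy hy'
    exact ⟨jordanSqrt_mem y, smul_one_sub_jordanSqrt_mem hy hy'⟩
  obtain ⟨s, hs, hle⟩ := hcpt.ultrafilter_le_nhds (U.map jordanSqrt)
    (Filter.le_principal_iff.2 hmem)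
  have hlim : Filter.Tendsto jordanSqrt (U : Filter V) (𝓝 s) := hle
  have h1 : Filter.Tendsto (fun y => jordanSqrt y * jordanSqrt y) (U : Filter V) (𝓝 (s * s)) :=
    hlim.mul hlim
  have h2 : Filter.Tendsto (fun y => jordanSqrt y * jordanSqrt y) (U : Filter V) (𝓝 t) := by
    refine hUt.congr' ?_
    filter_upwards [hQ] with y hy
    exact (jordanSqrt_mul_self hy).symm
  have h3 := tendsto_nhds_unique h1 h2
  rw [← h3, jordanSqrt_sq hs.1]
  exact hlim

/-- The same compactness argument, with the equation P(y)y⁻¹ = y, which survives limits and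
determines the inverse. -/
theorem continuousOn_jordanInv : ContinuousOn (jordanInv (V := V)) (posCone V) := by
  intro x hx
  obtain ⟨δ, hδ, hxδ⟩ := id hx
  have hev : ∀ᶠ y in 𝓝 x, y - (δ / 2) • (1 : V) ∈ squareCone V := by
    have h1 : Filter.Tendsto (fun y : V => y - x) (𝓝 x) (𝓝 0) :=
      tendsto_sub_nhds_zero_iff.2 Filter.tendsto_id
    filter_upwards [h1 (setOf_add_smul_one_mem_nhds_zero (half_pos hδ))] with y hy
    have := squareCone_add hxδ hy
    convert this using 1
    module
  refine (Filter.tendsto_iff_ultrafilter _ _ _).2 fun U hU => ?_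
  have hUt : Filter.Tendsto id (U : Filter V) (𝓝 x) := hU.trans nhdsWithin_le_nhds
  have hQ : ∀ᶠ y in (U : Filter V), y ∈ posCone V := hU self_mem_nhdsWithin
  have hcpt := isCompact_squareCone_Icc ((δ / 2)⁻¹ • (1 : V))
  have hmem : ∀ᶠ y in (U : Filter V), jordanInv y ∈
      {x : V | x ∈ squareCone V ∧ (δ / 2)⁻¹ • (1 : V) - x ∈ squareCone V} := by
    filter_upwards [hQ, hUt hev] with y hy hy'
    exact ⟨posCone_subset (jordanInv_mem_posCone hy),
      inv_smul_one_sub_jordanInv_mem (half_pos hδ) hy'⟩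
  obtain ⟨w, -, hle⟩ := hcpt.ultrafilter_le_nhds (U.map jordanInv) (Filter.le_principal_iff.2 hmem)
  have hlim : Filter.Tendsto jordanInv (U : Filter V) (𝓝 w) := hle
  have h1 : Filter.Tendsto (fun y => jordanP y (jordanInv y)) (U : Filter V) (𝓝 (jordanP x w)) :=
    tendsto_jordanP hUt hlim
  have h2 : Filter.Tendsto (fun y => jordanP y (jordanInv y)) (U : Filter V) (𝓝 x) := by
    refine hUt.congr' ?_
    filter_upwards [hQ] with y hy
    exact (jordanP_jordanInv_self hy).symm
  rw [← eq_jordanInv_of_jordanP hx (tendsto_nhds_unique h1 h2)]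
  exact hlim

end ConeTopology

/-! ### The flow P(exp τx), invariance of the cone, and order reversal -/

section Flow

variable {V : Type*} [NonAssocCommRing V] [Module ℝ V] [IsScalarTower ℝ V V] [SMulCommClass ℝ V V]
  [FiniteDimensional ℝ V] [TopologicalSpace V] [IsTopologicalAddGroup V] [ContinuousSMul ℝ V]
  [T2Space V]

variable {ι : Type*} [Fintype ι] {c : ι → V}

/-- The one-parameter group `exp(τ x)` for `x = ∑ lᵢ cᵢ`. -/
noncomputable def frameExp (c : ι → V) (l : ι → ℝ) (τ : ℝ) : V :=
  frameSum c fun i => Real.exp (τ * l i)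

theorem continuous_frameExp (c : ι → V) (l : ι → ℝ) : Continuous (frameExp c l) := by
  unfold frameExp frameSum
  fun_prop

theorem IsIdempotentFrame.frameExp_zero (hc : IsIdempotentFrame c) (l : ι → ℝ) :
    frameExp c l 0 = 1 := by
  simp [frameExp, hc.frameSum_one]

theorem tendsto_frameExp_slope (hc : IsIdempotentFrame c) (l : ι → ℝ) :
    Filter.Tendsto (fun σ : ℝ => σ⁻¹ • (frameExp c l σ - 1)) (𝓝[≠] 0) (𝓝 (frameSum c l)) := by
  have h : (fun σ : ℝ => σ⁻¹ • (frameExp c l σ - 1))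
      = fun σ => ∑ i, (σ⁻¹ * (Real.exp (σ * l i) - 1)) • c i := by
    funext σ
    rw [← hc.frameSum_one, frameExp, frameSum_sub, frameSum_smul, frameSum]
  rw [h]
  refine tendsto_finsetSum _ fun i _ => Filter.Tendsto.smul_const ?_ _
  have hd : HasDerivAt (fun τ : ℝ => Real.exp (τ * l i)) (l i) 0 := by
    simpa using ((hasDerivAt_id (0 : ℝ)).mul_const (l i)).exp
  simpa using hasDerivAt_iff_tendsto_slope_zero.1 hd

/-- P(exp σx) has derivative 2L(x) at 0, by expanding P(1 + σX) with X → x. The vector may vary with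
σ because it will be the moving inverse. -/
theorem tendsto_jordanP_frameExp_slope (hc : IsIdempotentFrame c) (l : ι → ℝ) {v : ℝ → V} {v₀ : V}
    (hv : Filter.Tendsto v (𝓝[≠] 0) (𝓝 v₀)) :
    Filter.Tendsto (fun σ : ℝ => σ⁻¹ • (jordanP (frameExp c l σ) (v σ) - v σ)) (𝓝[≠] 0)
      (𝓝 ((2 : ℝ) • (frameSum c l * v₀))) := by
  have := continuousMul_of_finiteDimensional (V := V)
  have hX := tendsto_frameExp_slope hc l
  have h0 : Filter.Tendsto (fun σ : ℝ => σ) (𝓝[≠] 0) (𝓝 0) :=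
    Filter.tendsto_id.mono_left nhdsWithin_le_nhds
  have hlim := ((hX.mul hv).const_smul (2 : ℝ)).add (h0.smul (tendsto_jordanP hX hv))
  rw [zero_smul, add_zero] at hlim
  refine hlim.congr' ?_
  filter_upwards [self_mem_nhdsWithin] with σ hσ
  have hσ' : σ ≠ 0 := hσ
  have hS : frameExp c l σ = 1 + σ • (σ⁻¹ • (frameExp c l σ - 1)) := by
    rw [smul_smul, mul_inv_cancel₀ hσ', one_smul]; abel
  set X := σ⁻¹ • (frameExp c l σ - 1) with hXdef
  rw [hS, jordanP_one_add_smul, add_assoc, add_sub_cancel_left, smul_add, smul_smul, smul_smul]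
  congr 2
  · field_simp
  · field_simp

variable [IsCommJordan V]

theorem IsIdempotentFrame.jordanP_frameExp_add (hc : IsIdempotentFrame c) (l : ι → ℝ) (τ σ : ℝ)
    (v : V) : jordanP (frameExp c l (τ + σ)) v
      = jordanP (frameExp c l τ) (jordanP (frameExp c l σ) v) := by
  rw [frameExp, frameExp, frameExp, hc.jordanP_jordanP]
  simp only [add_mul, Real.exp_add]

theorem IsIdempotentFrame.jordanP_frameExp_neg (hc : IsIdempotentFrame c) (l : ι → ℝ) (τ : ℝ)
    (v : V) : jordanP (frameExp c l (-τ)) (jordanP (frameExp c l τ) v) = v := by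
  rw [← hc.jordanP_frameExp_add, neg_add_cancel, hc.frameExp_zero, jordanP_one]

variable [IsEuclideanAlgebra V]

theorem sub_inv_smul_one_mem_of_jordanInv_le {y : V} (hy : y ∈ posCone V) {K : ℝ}
    (h : K • (1 : V) - jordanInv y ∈ squareCone V) : y - K⁻¹ • (1 : V) ∈ squareCone V := by
  obtain ⟨S, c, hc, rfl⟩ := exists_frameSum_eq y
  have hy' := hc.frameSum_mem_posCone_iff.1 hy
  rw [hc.jordanInv_frameSum fun i => (hy' i).ne', ← hc.frameSum_const, frameSum_sub,
    hc.frameSum_mem_squareCone_iff] at h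
  rw [← hc.frameSum_const, frameSum_sub, hc.frameSum_mem_squareCone_iff]
  intro i
  exact sub_nonneg.2 (inv_le_of_inv_le₀ (hy' i) (sub_nonneg.1 (h i)))

/-- Product rule: the 2xY⁻¹ from differentiating P(exp τx) cancels the derivative -2xY⁻¹ of the
inverse. -/
theorem tendsto_jordanInv_flow_slope (hc : IsIdempotentFrame c) (l : ι → ℝ) (y : V) {τ : ℝ}
    (hτ : jordanP (frameExp c l τ) y ∈ posCone V) :
    Filter.Tendsto (fun σ : ℝ => σ⁻¹ • (jordanP (frameExp c l (τ + σ))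
        (jordanInv (jordanP (frameExp c l (τ + σ)) y))
        - jordanP (frameExp c l τ) (jordanInv (jordanP (frameExp c l τ) y)))) (𝓝[≠] 0) (𝓝 0) := by
  have := continuousMul_of_finiteDimensional (V := V)
  set Y : ℝ → V := fun t => jordanP (frameExp c l t) y with hY
  set x := frameSum c l with hx
  have hYc : Continuous Y := continuous_jordanP_comp (continuous_frameExp c l) continuous_const
  have h0 : Filter.Tendsto (fun σ : ℝ => σ) (𝓝[≠] 0) (𝓝 0) :=
    Filter.tendsto_id.mono_left nhdsWithin_le_nhds
  have hadd : Filter.Tendsto (fun σ : ℝ => τ + σ) (𝓝[≠] 0) (𝓝 τ) := by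
    simpa using h0.const_add τ
  have hYlim : Filter.Tendsto (fun σ => Y (τ + σ)) (𝓝[≠] 0) (𝓝 (Y τ)) :=
    (hYc.tendsto τ).comp hadd
  have hmem : ∀ᶠ σ in 𝓝[≠] (0 : ℝ), Y (τ + σ) ∈ posCone V :=
    hYlim.eventually (isOpen_posCone.mem_nhds hτ)
  have hWlim : Filter.Tendsto (fun σ => jordanInv (Y (τ + σ))) (𝓝[≠] 0) (𝓝 (jordanInv (Y τ))) :=
    ((continuousOn_jordanInv.continuousAt (isOpen_posCone.mem_nhds hτ)).tendsto).comp hYlim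
  have hk : Filter.Tendsto (fun σ : ℝ => σ⁻¹ • (Y (τ + σ) - Y τ)) (𝓝[≠] 0)
      (𝓝 ((2 : ℝ) • (x * Y τ))) := by
    refine (tendsto_jordanP_frameExp_slope hc l
      (tendsto_const_nhds : Filter.Tendsto (fun _ : ℝ => Y τ) (𝓝[≠] 0) (𝓝 (Y τ)))).congr
        fun σ => ?_
    rw [hY]
    simp only
    rw [add_comm τ σ, hc.jordanP_frameExp_add]
  -- By `jordanInv_sub_jordanInv`, where the quadratic term contributes O(σ), the limit is
  -- -P(Y⁻¹)(2xY) = -2xY⁻¹.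
  have hW : Filter.Tendsto (fun σ : ℝ => σ⁻¹ • (jordanInv (Y (τ + σ)) - jordanInv (Y τ))) (𝓝[≠] 0)
      (𝓝 (-((2 : ℝ) • (x * jordanInv (Y τ))))) := by
    have hlim := (tendsto_jordanP hWlim (hk.add (h0.smul
      (tendsto_jordanP hk (tendsto_const_nhds (x := jordanInv (Y τ))))))).neg
    rw [zero_smul, add_zero, map_smul, mul_comm x (Y τ), jordanP_jordanInv_mul hτ,
      mul_comm _ x] at hlim
    refine hlim.congr' ?_
    filter_upwards [hmem, self_mem_nhdsWithin] with σ hσ hσ0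
    have hσ' : σ ≠ 0 := hσ0
    have hsmul : σ • jordanP (σ⁻¹ • (Y (τ + σ) - Y τ)) (jordanInv (Y τ))
        = σ⁻¹ • jordanP (Y (τ + σ) - Y τ) (jordanInv (Y τ)) := by
      rw [jordanP_smul, smul_smul]
      congr 1
      field_simp
    rw [hsmul, ← smul_add, map_smul, jordanInv_sub_jordanInv (x := Y τ) hτ hσ, smul_neg]
  have hsum := tendsto_jordanP (tendsto_const_nhds (x := frameExp c l τ))
    ((tendsto_jordanP_frameExp_slope hc l hWlim).add hW)
  rw [add_neg_cancel, map_zero] at hsum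
  refine hsum.congr fun σ => ?_
  rw [← smul_add, map_smul, hc.jordanP_frameExp_add l τ σ (jordanInv _), ← map_sub]
  congr 2
  abel

/-- The set of times at which both claims hold is clopen in ℝ and contains 0. Proving them together
matters: the formula for the inverse keeps Y away from the boundary of the cone. -/
theorem IsIdempotentFrame.frameExp_flow (hc : IsIdempotentFrame c) (l : ι → ℝ) {y : V}
    (hy : y ∈ posCone V) (τ : ℝ) : jordanP (frameExp c l τ) y ∈ posCone V ∧
      jordanP (frameExp c l τ) (jordanInv (jordanP (frameExp c l τ) y)) = jordanInv y := by
  obtain ⟨B, hB⟩ := exists_isEuclideanForm V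
  set Y : ℝ → V := fun t => jordanP (frameExp c l t) y with hY
  set Φ : ℝ → V := fun t => jordanP (frameExp c l t) (jordanInv (Y t)) with hΦ
  have hYc : Continuous Y := continuous_jordanP_comp (continuous_frameExp c l) continuous_const
  have hΩ : IsOpen {t | Y t ∈ posCone V} := isOpen_posCone.preimage hYc
  set A : Set ℝ := {t | Y t ∈ posCone V ∧ Φ t = jordanInv y} with hA
  suffices h : A = univ from (h ▸ mem_univ τ : τ ∈ A)
  refine IsClopen.eq_univ ⟨?_, ?_⟩ ⟨0, ?_, ?_⟩
  · rw [isClosed_iff_frequently]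
    intro t ht
    have hz : Continuous fun r : ℝ => jordanP (frameExp c l (-r)) (jordanInv y) :=
      continuous_jordanP_comp ((continuous_frameExp c l).comp continuous_neg) continuous_const
    -- At good times r near t, Y(r)⁻¹ = P(exp(-rx))y⁻¹ ≤ K, hence Y(r) ≥ K⁻¹; this bound passes to
    -- the limit t.
    obtain ⟨K, hK, hev⟩ := eventually_smul_one_sub_mem (jordanP (frameExp c l (-t)) (jordanInv y))
    have hev' := (hz.tendsto t).eventually hev
    have h1 : ∃ᶠ r in 𝓝 t, Y r - K⁻¹ • (1 : V) ∈ squareCone V := by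
      refine (ht.and_eventually hev').mono ?_
      rintro r ⟨⟨hr, hr'⟩, hrK⟩
      refine sub_inv_smul_one_mem_of_jordanInv_le hr ?_
      rwa [← hr', hΦ, hc.jordanP_frameExp_neg] at hrK
    have h2 : Y t - K⁻¹ • (1 : V) ∈ squareCone V :=
      isClosed_squareCone.mem_of_frequently_of_tendsto h1
        ((hYc.sub continuous_const).tendsto t)
    have h3 : Y t ∈ posCone V := ⟨K⁻¹, inv_pos.2 hK, h2⟩
    refine ⟨h3, ?_⟩
    have h4 : Filter.Tendsto Φ (𝓝 t) (𝓝 (Φ t)) :=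
      tendsto_jordanP ((continuous_frameExp c l).tendsto t)
        ((continuousOn_jordanInv.continuousAt (isOpen_posCone.mem_nhds h3)).tendsto.comp
          (hYc.tendsto t))
    exact isClosed_singleton.mem_of_frequently_of_tendsto (s := {jordanInv y})
      (ht.mono fun r hr => hr.2) h4
  · rw [Metric.isOpen_iff]
    rintro t ⟨ht, ht'⟩
    obtain ⟨ε, hε, hball⟩ := Metric.isOpen_iff.1 hΩ t ht
    refine ⟨ε, hε, fun r hr => ⟨hball hr, ?_⟩⟩
    -- Constancy of Φ is tested through the real functions B(v, Φ), since V carries no chosen norm.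
    have hder : ∀ v : V, ∀ q ∈ Metric.ball t ε, HasDerivAt (fun r => B v (Φ r)) 0 q := by
      intro v q hq
      rw [hasDerivAt_iff_tendsto_slope_zero]
      have h := ((B v).continuous_of_finiteDimensional.tendsto 0).comp
        (tendsto_jordanInv_flow_slope hc l y (hball hq))
      rw [map_zero] at h
      refine h.congr fun σ => ?_
      simp only [Function.comp_apply, map_smul, map_sub]
      rfl
    have hconst : ∀ v : V, B v (Φ r) = B v (Φ t) := fun v =>
      Metric.isOpen_ball.is_const_of_deriv_eq_zero (convex_ball t ε).isPreconnected
        (fun q hq => (hder v q hq).differentiableAt.differentiableWithinAt)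
        (fun q hq => (hder v q hq).deriv) hr (Metric.mem_ball_self hε)
    rw [← ht', ← sub_eq_zero]
    by_contra hne
    have h := hB.pos _ hne
    rw [map_sub, hconst, sub_self] at h
    exact lt_irrefl _ h
  · simpa [hY, hc.frameExp_zero, jordanP_one] using hy
  · simp [hΦ, hY, hc.frameExp_zero, jordanP_one]

theorem exists_frameExp_eq {s : V} (hs : s ∈ posCone V) :
    ∃ (S : Finset ℝ) (c : S → V) (l : S → ℝ), IsIdempotentFrame c ∧ frameExp c l 1 = s := by
  obtain ⟨S, c, hc, rfl⟩ := exists_frameSum_eq s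
  rw [hc.frameSum_mem_posCone_iff] at hs
  refine ⟨S, c, fun i => Real.log i, hc, ?_⟩
  rw [frameExp]
  congr 1; funext i
  rw [one_mul, Real.exp_log (hs i)]

theorem jordanP_mem_posCone {s y : V} (hs : s ∈ posCone V) (hy : y ∈ posCone V) :
    jordanP s y ∈ posCone V := by
  obtain ⟨S, c, l, hc, rfl⟩ := exists_frameExp_eq hs
  exact (hc.frameExp_flow l hy 1).1

theorem jordanInv_jordanP {s y : V} (hs : s ∈ posCone V) (hy : y ∈ posCone V) :
    jordanInv (jordanP s y) = jordanP (jordanInv s) (jordanInv y) := by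
  have h : jordanP s (jordanInv (jordanP s y)) = jordanInv y := by
    obtain ⟨S, c, l, hc, rfl⟩ := exists_frameExp_eq hs
    exact (hc.frameExp_flow l hy 1).2
  rw [← h, jordanP_jordanInv_apply hs]

theorem tendsto_add_smul_one (x : V) :
    Filter.Tendsto (fun ε : ℝ => x + ε • (1 : V)) (𝓝[>] 0) (𝓝 x) := by
  have h : Continuous fun r : ℝ => x + r • (1 : V) := by fun_prop
  have h0 := h.tendsto 0
  rw [zero_smul, add_zero] at h0
  exact h0.mono_left nhdsWithin_le_nhds

theorem add_smul_one_mem_posCone {x : V} (hx : x ∈ squareCone V) {ε : ℝ} (hε : 0 < ε) :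
    x + ε • (1 : V) ∈ posCone V := ⟨ε, hε, by rwa [add_sub_cancel_right]⟩

theorem jordanP_mem_squareCone {s y : V} (hs : s ∈ squareCone V) (hy : y ∈ squareCone V) :
    jordanP s y ∈ squareCone V := by
  refine isClosed_squareCone.mem_of_tendsto
    (tendsto_jordanP (tendsto_add_smul_one s) (tendsto_add_smul_one y)) ?_
  filter_upwards [self_mem_nhdsWithin] with ε hε
  exact posCone_subset (jordanP_mem_posCone (add_smul_one_mem_posCone hs hε)
    (add_smul_one_mem_posCone hy hε))

/-- Inversion reverses the order. -/
theorem jordanInv_antitone {x y : V} (hx : x ∈ posCone V) (hxy : y - x ∈ squareCone V) :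
    jordanInv x - jordanInv y ∈ squareCone V := by
  have hy := posCone_of_sub_mem hx hxy
  set s := jordanSqrt x with hs
  have hsp : s ∈ posCone V := jordanSqrt_mem_posCone hx
  have hss : s * s = x := jordanSqrt_mul_self (posCone_subset hx)
  have hsi := jordanInv_mem_posCone hsp
  -- Applying P(s⁻¹) with s = √x reduces the claim to x = 1, where it is spectral.
  have hPx : jordanP (jordanInv s) x = 1 := by
    rw [← hss, ← jordanP_apply_one, jordanP_jordanInv_apply hsp]
  have h1 : jordanP (jordanInv s) y - (1 : ℝ) • (1 : V) ∈ squareCone V := by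
    rw [one_smul, ← hPx, ← map_sub]
    exact jordanP_mem_squareCone (posCone_subset hsi) hxy
  have h2 := inv_smul_one_sub_jordanInv_mem one_pos h1
  rw [inv_one, one_smul, jordanInv_jordanP hsi hy, jordanInv_jordanInv hsp] at h2
  have h3 := jordanP_mem_squareCone (posCone_subset hsi) h2
  rw [map_sub, jordanP_jordanInv_apply hsp] at h3
  have h4 : jordanP (jordanInv s) 1 = jordanInv x := by
    rw [jordanP_apply_one, jordanInv_mul_self hsp, hss]
  rwa [h4] at h3

end Flow

/-! ### The extended parallel sum (t⁻¹ + a)⁻¹ -/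

section ParallelSum

variable {V : Type*} [NonAssocCommRing V] [Module ℝ V] [IsScalarTower ℝ V V] [SMulCommClass ℝ V V]
  [IsCommJordan V] [IsEuclideanAlgebra V] [FiniteDimensional ℝ V]

/-- `P(√t) (1 + P(√t) a)⁻¹`, which is `(t⁻¹ + a)⁻¹` if `t` is invertible. -/
noncomputable def parSum (t a : V) : V :=
  jordanP (jordanSqrt t) (jordanInv (1 + jordanP (jordanSqrt t) a))

/-- The domain of `parSum`. -/
def ParDom (t a : V) : Prop := 1 + jordanP (jordanSqrt t) a ∈ posCone V

theorem jordanP_jordanSqrt_one {t : V} (ht : t ∈ squareCone V) : jordanP (jordanSqrt t) 1 = t := by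
  rw [jordanP_apply_one, jordanSqrt_mul_self ht]

theorem jordanP_jordanSqrt_inv {t : V} (ht : t ∈ posCone V) :
    jordanP (jordanSqrt t) (jordanInv t) = 1 := by
  have hs := jordanSqrt_mem_posCone ht
  conv_lhs => rw [← jordanSqrt_mul_self (posCone_subset ht)]
  rw [jordanSqrt_sq (posCone_subset hs), ← jordanInv_mul_self hs, ← jordanP_apply_one,
    jordanP_apply_jordanInv hs]

theorem parDom_zero (t : V) : ParDom t 0 := by
  rw [ParDom, map_zero, add_zero]
  exact one_mem_posCone

theorem parSum_zero {t : V} (ht : t ∈ squareCone V) : parSum t 0 = t := by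
  rw [parSum, map_zero, add_zero, jordanInv_one, jordanP_jordanSqrt_one ht]

theorem IsIdempotentFrame.parDom_frameSum_iff {ι : Type*} [Fintype ι] {c : ι → V}
    (hc : IsIdempotentFrame c) {l : ι → ℝ} (m : ι → ℝ) (hl : ∀ i, 0 ≤ l i) :
    ParDom (frameSum c l) (frameSum c m) ↔ ∀ i, 0 < 1 + l i * m i := by
  rw [ParDom, hc.jordanSqrt_frameSum, hc.jordanP_mul_self, ← hc.frameSum_one, frameSum_add,
    hc.frameSum_mem_posCone_iff]
  simp only [Real.mul_self_sqrt (hl _)]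

theorem IsIdempotentFrame.parSum_frameSum {ι : Type*} [Fintype ι] {c : ι → V}
    (hc : IsIdempotentFrame c) {l m : ι → ℝ} (hl : ∀ i, 0 ≤ l i) (h : ∀ i, 0 < 1 + l i * m i) :
    parSum (frameSum c l) (frameSum c m) = frameSum c fun i => l i / (1 + l i * m i) := by
  rw [parSum, hc.jordanSqrt_frameSum, hc.jordanP_mul_self, ← hc.frameSum_one, frameSum_add]
  simp only [Real.mul_self_sqrt (hl _)]
  rw [hc.jordanInv_frameSum fun i => (h i).ne', hc.jordanP_mul_self]
  simp only [Real.mul_self_sqrt (hl _), div_eq_mul_inv]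

theorem one_sub_jordanInv_one_add_inv {b : V} (hb : b ∈ posCone V) :
    1 - jordanInv (1 + jordanInv b) = jordanInv (1 + b) := by
  obtain ⟨S, c, hc, rfl⟩ := exists_frameSum_eq b
  have h := hc.frameSum_mem_posCone_iff.1 hb
  have h1 : ∀ i : S, 0 < 1 + (i : ℝ) := fun i => by linarith [h i]
  have h2 : ∀ i : S, 0 < 1 + (i : ℝ)⁻¹ := fun i => add_pos one_pos (inv_pos.2 (h i))
  rw [hc.jordanInv_frameSum fun i => (h i).ne', ← hc.frameSum_one, frameSum_add, frameSum_add,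
    hc.jordanInv_frameSum fun i => (h1 i).ne', hc.jordanInv_frameSum fun i => (h2 i).ne',
    frameSum_sub]
  congr 1; funext i
  have := (h i).ne'
  have := (h1 i).ne'
  have e : 1 + (i : ℝ)⁻¹ = (1 + i) / i := by field_simp; ring
  rw [e, inv_div]
  field_simp
  ring

theorem one_sub_jordanInv_one_add_mem {b : V} (hb : b ∈ posCone V) :
    1 - jordanInv (1 + b) ∈ posCone V := by
  rw [← one_sub_jordanInv_one_add_inv hb, sub_sub_cancel]
  exact jordanInv_mem_posCone (posCone_add one_mem_posCone
    (posCone_subset (jordanInv_mem_posCone hb)))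

variable [TopologicalSpace V] [IsTopologicalAddGroup V] [ContinuousSMul ℝ V] [T2Space V]

theorem ParDom.of_mem {t a : V} (ha : a ∈ squareCone V) : ParDom t a :=
  posCone_add one_mem_posCone (jordanP_mem_squareCone (jordanSqrt_mem t) ha)

theorem ParDom.parSum_mem {t a : V} (h : ParDom t a) : parSum t a ∈ squareCone V :=
  jordanP_mem_squareCone (jordanSqrt_mem t) (posCone_subset (jordanInv_mem_posCone h))

theorem sub_parSum_mem {t a : V} (ht : t ∈ squareCone V) (ha : a ∈ squareCone V) :
    t - parSum t a ∈ squareCone V := by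
  have h : 1 + jordanP (jordanSqrt t) a - (1 : ℝ) • (1 : V) ∈ squareCone V := by
    rw [one_smul, add_sub_cancel_left]
    exact jordanP_mem_squareCone (jordanSqrt_mem t) ha
  have h1 := jordanP_mem_squareCone (jordanSqrt_mem t) (inv_smul_one_sub_jordanInv_mem one_pos h)
  rwa [inv_one, one_smul, map_sub, jordanP_jordanSqrt_one ht] at h1

/-- 1 + P(√t)a = P(√t)(t⁻¹ + a), and both P(√t) and its inverse preserve the open cone. -/
theorem parDom_iff {t : V} (ht : t ∈ posCone V) (a : V) :
    ParDom t a ↔ jordanInv t + a ∈ posCone V := by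
  have hs := jordanSqrt_mem_posCone ht
  have e : jordanP (jordanSqrt t) (jordanInv t + a) = 1 + jordanP (jordanSqrt t) a := by
    rw [map_add, jordanP_jordanSqrt_inv ht]
  rw [ParDom, ← e]
  refine ⟨fun h => ?_, jordanP_mem_posCone hs⟩
  have := jordanP_mem_posCone (jordanInv_mem_posCone hs) h
  rwa [jordanP_jordanInv_apply hs] at this

theorem parSum_eq {t a : V} (ht : t ∈ posCone V) (h : ParDom t a) :
    parSum t a = jordanInv (jordanInv t + a) := by
  have hs := jordanSqrt_mem_posCone ht
  have e : jordanP (jordanSqrt t) (jordanInv t + a) = 1 + jordanP (jordanSqrt t) a := by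
    rw [map_add, jordanP_jordanSqrt_inv ht]
  rw [parSum, ← e, jordanInv_jordanP hs ((parDom_iff ht a).1 h), jordanP_apply_jordanInv hs]

theorem jordanP_mem_squareCone_iff {s z : V} (hs : s ∈ posCone V) :
    jordanP s z ∈ squareCone V ↔ z ∈ squareCone V := by
  refine ⟨fun h => ?_, jordanP_mem_squareCone (posCone_subset hs)⟩
  have := jordanP_mem_squareCone (posCone_subset (jordanInv_mem_posCone hs)) h
  rwa [jordanP_jordanInv_apply hs] at this

/-- Both sides are images of t⁻¹ + a + b - δ(t⁻¹ + a) under operators P(s) with s positive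
invertible. The constant δ makes positivity quantitative, so that it survives the limit to singular
t. -/
theorem one_add_jordanP_parSum_iff {t a : V} (ht : t ∈ posCone V) (h : ParDom t a) (b : V) (δ : ℝ) :
    1 + jordanP (jordanSqrt (parSum t a)) b - δ • (1 : V) ∈ squareCone V ↔
      1 + jordanP (jordanSqrt t) (a + b) - δ • (1 + jordanP (jordanSqrt t) a) ∈ squareCone V := by
  have h1 := (parDom_iff ht a).1 h
  have hw : parSum t a ∈ posCone V := by
    rw [parSum_eq ht h]; exact jordanInv_mem_posCone h1
  have hwi : jordanInv (parSum t a) = jordanInv t + a := by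
    rw [parSum_eq ht h, jordanInv_jordanInv h1]
  have e1 : 1 + jordanP (jordanSqrt (parSum t a)) b - δ • (1 : V)
      = jordanP (jordanSqrt (parSum t a)) (jordanInv t + a + b - δ • (jordanInv t + a)) := by
    rw [← hwi, map_sub, map_smul, map_add, jordanP_jordanSqrt_inv hw]
  have e2 : 1 + jordanP (jordanSqrt t) (a + b) - δ • (1 + jordanP (jordanSqrt t) a)
      = jordanP (jordanSqrt t) (jordanInv t + a + b - δ • (jordanInv t + a)) := by
    simp only [map_sub, map_smul, map_add, jordanP_jordanSqrt_inv ht, add_assoc]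
  rw [e1, e2, jordanP_mem_squareCone_iff (jordanSqrt_mem_posCone hw),
    jordanP_mem_squareCone_iff (jordanSqrt_mem_posCone ht)]

theorem tendsto_one_add_jordanP {α : Type*} {l : Filter α} {f g : α → V} {t a : V}
    (ht : t ∈ squareCone V) (hf : Filter.Tendsto f l (𝓝 t)) (hfQ : ∀ᶠ x in l, f x ∈ squareCone V)
    (hg : Filter.Tendsto g l (𝓝 a)) : Filter.Tendsto (fun x => 1 + jordanP (jordanSqrt (f x)) (g x))
      l (𝓝 (1 + jordanP (jordanSqrt t) a)) :=
  (tendsto_jordanP ((continuousOn_jordanSqrt t ht).tendsto.comp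
    (tendsto_nhdsWithin_iff.2 ⟨hf, hfQ⟩)) hg).const_add 1

theorem eventually_parDom {α : Type*} {l : Filter α} {f g : α → V} {t a : V}
    (ht : t ∈ squareCone V) (h : ParDom t a) (hf : Filter.Tendsto f l (𝓝 t))
    (hfQ : ∀ᶠ x in l, f x ∈ squareCone V) (hg : Filter.Tendsto g l (𝓝 a)) :
    ∀ᶠ x in l, ParDom (f x) (g x) :=
  (tendsto_one_add_jordanP ht hf hfQ hg).eventually (isOpen_posCone.mem_nhds h)

theorem tendsto_parSum {α : Type*} {l : Filter α} {f g : α → V} {t a : V}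
    (ht : t ∈ squareCone V) (h : ParDom t a) (hf : Filter.Tendsto f l (𝓝 t))
    (hfQ : ∀ᶠ x in l, f x ∈ squareCone V) (hg : Filter.Tendsto g l (𝓝 a)) :
    Filter.Tendsto (fun x => parSum (f x) (g x)) l (𝓝 (parSum t a)) :=
  tendsto_jordanP ((continuousOn_jordanSqrt t ht).tendsto.comp
    (tendsto_nhdsWithin_iff.2 ⟨hf, hfQ⟩))
    ((continuousOn_jordanInv.continuousAt (isOpen_posCone.mem_nhds h)).tendsto.comp
      (tendsto_one_add_jordanP ht hf hfQ hg))

theorem eventually_add_smul_one_mem {t : V} (ht : t ∈ squareCone V) :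
    ∀ᶠ ε in 𝓝[>] (0 : ℝ), t + ε • (1 : V) ∈ posCone V := by
  filter_upwards [self_mem_nhdsWithin] with ε hε
  exact add_smul_one_mem_posCone ht hε

theorem eventually_add_smul_one_mem' {t : V} (ht : t ∈ squareCone V) :
    ∀ᶠ ε in 𝓝[>] (0 : ℝ), t + ε • (1 : V) ∈ squareCone V :=
  (eventually_add_smul_one_mem ht).mono fun _ => posCone_subset

theorem parDom_parSum_iff {t a : V} (ht : t ∈ squareCone V) (h : ParDom t a) (b : V) :
    ParDom (parSum t a) b ↔ ParDom t (a + b) := by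
  have hT := tendsto_add_smul_one t
  have hTQ := eventually_add_smul_one_mem' ht
  have hTp := eventually_add_smul_one_mem ht
  have hdom := eventually_parDom ht h hT hTQ (tendsto_const_nhds (x := a))
  have hw := tendsto_parSum ht h hT hTQ (tendsto_const_nhds (x := a))
  have hwQ : ∀ᶠ ε in 𝓝[>] (0 : ℝ), parSum (t + ε • (1 : V)) a ∈ squareCone V :=
    hdom.mono fun _ h => h.parSum_mem
  have hwb := tendsto_one_add_jordanP h.parSum_mem hw hwQ (tendsto_const_nhds (x := b))
  have hta := tendsto_one_add_jordanP ht hT hTQ (tendsto_const_nhds (x := a))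
  have htab := tendsto_one_add_jordanP ht hT hTQ (tendsto_const_nhds (x := a + b))
  constructor
  · rintro ⟨δ, hδ, hδ'⟩
    -- Halving δ makes the inequality strict, hence valid for t + ε with small ε.
    have hopen : 1 + jordanP (jordanSqrt (parSum t a)) b - (δ / 2) • (1 : V) ∈ posCone V := by
      refine ⟨δ / 2, half_pos hδ, ?_⟩
      convert hδ' using 1
      module
    have h1 := (hwb.sub_const ((δ / 2) • (1 : V))).eventually (isOpen_posCone.mem_nhds hopen)
    have h2 : 1 + jordanP (jordanSqrt t) (a + b) - (δ / 2) • (1 + jordanP (jordanSqrt t) a)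
        ∈ squareCone V := by
      refine isClosed_squareCone.mem_of_tendsto (htab.sub (hta.const_smul (δ / 2))) ?_
      filter_upwards [h1, hTp, hdom] with ε h1 h2 h3
      exact (one_add_jordanP_parSum_iff h2 h3 b _).1 (posCone_subset h1)
    exact posCone_of_sub_mem (posCone_smul h (half_pos hδ)) h2
  · intro hab
    obtain ⟨δ, hδ, hδ'⟩ : ∃ δ : ℝ, 0 < δ ∧
        1 + jordanP (jordanSqrt t) (a + b) - δ • (1 + jordanP (jordanSqrt t) a) ∈ posCone V := by
      have hcont : Continuous fun δ : ℝ =>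
          1 + jordanP (jordanSqrt t) (a + b) - δ • (1 + jordanP (jordanSqrt t) a) := by fun_prop
      have h0 := (hcont.tendsto 0).mono_left (nhdsWithin_le_nhds (s := Ioi 0))
      rw [zero_smul, sub_zero] at h0
      obtain ⟨δ, h1, h2⟩ :=
        ((h0.eventually (isOpen_posCone.mem_nhds hab)).and self_mem_nhdsWithin).exists
      exact ⟨δ, h2, h1⟩
    have h1 := (htab.sub (hta.const_smul δ)).eventually (isOpen_posCone.mem_nhds hδ')
    refine ⟨δ, hδ, ?_⟩
    refine isClosed_squareCone.mem_of_tendsto (hwb.sub_const (δ • (1 : V))) ?_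
    filter_upwards [h1, hTp, hdom] with ε h1 h2 h3
    exact (one_add_jordanP_parSum_iff h2 h3 b _).2 (posCone_subset h1)

/-- For invertible t both sides are (t⁻¹ + a + b)⁻¹; continuity along t + ε gives the general case.
-/
theorem parSum_parSum {t a b : V} (ht : t ∈ squareCone V) (h : ParDom t a)
    (hab : ParDom t (a + b)) : parSum (parSum t a) b = parSum t (a + b) := by
  have hT := tendsto_add_smul_one t
  have hTQ := eventually_add_smul_one_mem' ht
  have hTp := eventually_add_smul_one_mem ht
  have hdom := eventually_parDom ht h hT hTQ (tendsto_const_nhds (x := a))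
  have hdom' := eventually_parDom ht hab hT hTQ (tendsto_const_nhds (x := a + b))
  have hw := tendsto_parSum ht h hT hTQ (tendsto_const_nhds (x := a))
  have hwQ : ∀ᶠ ε in 𝓝[>] (0 : ℝ), parSum (t + ε • (1 : V)) a ∈ squareCone V :=
    hdom.mono fun _ h => h.parSum_mem
  have h1 := tendsto_parSum h.parSum_mem ((parDom_parSum_iff ht h b).2 hab) hw hwQ
    (tendsto_const_nhds (x := b))
  have h2 := tendsto_parSum ht hab hT hTQ (tendsto_const_nhds (x := a + b))
  refine tendsto_nhds_unique_of_eventuallyEq h1 h2 ?_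
  filter_upwards [hTp, hdom, hdom'] with ε hε hd hd'
  have hd1 := (parDom_iff hε a).1 hd
  have hwp : parSum (t + ε • (1 : V)) a ∈ posCone V := by
    rw [parSum_eq hε hd]; exact jordanInv_mem_posCone hd1
  rw [parSum_eq hwp ((parDom_parSum_iff (posCone_subset hε) hd b).2 hd'), parSum_eq hε hd,
    jordanInv_jordanInv hd1, parSum_eq hε hd', add_assoc]

theorem parDom_parSum_neg {t a : V} (ht : t ∈ squareCone V) (h : ParDom t a) :
    ParDom (parSum t a) (-a) := by
  rw [parDom_parSum_iff ht h, add_neg_cancel]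
  exact parDom_zero t

theorem parSum_parSum_neg {t a : V} (ht : t ∈ squareCone V) (h : ParDom t a) :
    parSum (parSum t a) (-a) = t := by
  rw [parSum_parSum ht h] <;> rw [add_neg_cancel]
  · exact parSum_zero ht
  · exact parDom_zero t

/-- For invertible elements, t ↦ (t⁻¹ + a)⁻¹ reverses the order twice; then let ε → 0. -/
theorem parSum_mono {v w a : V} (hv : v ∈ squareCone V) (hvw : w - v ∈ squareCone V)
    (hva : ParDom v a) (hwa : ParDom w a) : parSum w a - parSum v a ∈ squareCone V := by
  have hw : w ∈ squareCone V := by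
    have := squareCone_add hv hvw
    rwa [add_sub_cancel] at this
  have h1 := tendsto_parSum hv hva (tendsto_add_smul_one v) (eventually_add_smul_one_mem' hv)
    (tendsto_const_nhds (x := a))
  have h2 := tendsto_parSum hw hwa (tendsto_add_smul_one w) (eventually_add_smul_one_mem' hw)
    (tendsto_const_nhds (x := a))
  have d1 := eventually_parDom hv hva (tendsto_add_smul_one v) (eventually_add_smul_one_mem' hv)
    (tendsto_const_nhds (x := a))
  have d2 := eventually_parDom hw hwa (tendsto_add_smul_one w) (eventually_add_smul_one_mem' hw)
    (tendsto_const_nhds (x := a))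
  refine isClosed_squareCone.mem_of_tendsto (h2.sub h1) ?_
  filter_upwards [d1, d2, eventually_add_smul_one_mem hv, eventually_add_smul_one_mem hw]
    with ε hd1 hd2 hε1 hε2
  rw [parSum_eq hε1 hd1, parSum_eq hε2 hd2]
  refine jordanInv_antitone ((parDom_iff hε2 a).1 hd2) ?_
  rw [add_sub_add_right_eq_sub]
  exact jordanInv_antitone hε1 (by rwa [add_sub_add_right_eq_sub])

/-- Hua's identity. -/
theorem parSum_eq_sub {t a : V} (ht : t ∈ squareCone V) (ha : a ∈ posCone V) :
    parSum t a = t - jordanP t (jordanInv (t + jordanInv a)) := by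
  have hai := jordanInv_mem_posCone ha
  have hta : t + jordanInv a ∈ posCone V := by
    rw [add_comm]; exact posCone_add hai ht
  have hT := tendsto_add_smul_one t
  have h1 := tendsto_parSum ht (ParDom.of_mem (posCone_subset ha)) hT
    (eventually_add_smul_one_mem' ht) (tendsto_const_nhds (x := a))
  have h2 := hT.sub (tendsto_jordanP hT
    ((continuousOn_jordanInv.continuousAt (isOpen_posCone.mem_nhds hta)).tendsto.comp
      (hT.add_const (jordanInv a))))
  refine tendsto_nhds_unique_of_eventuallyEq h1 h2 ?_
  filter_upwards [eventually_add_smul_one_mem ht] with ε hε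
  simp only [Function.comp_apply]
  set r := t + ε • (1 : V) with hr
  set s := jordanSqrt r with hs
  have hsp : s ∈ posCone V := jordanSqrt_mem_posCone hε
  have hsi := jordanInv_mem_posCone hsp
  have hb := jordanP_mem_posCone hsp ha
  have hbi := jordanInv_mem_posCone hb
  -- With r = s² and b = P(s)a, Hua's identity becomes P(s) applied to 1 - (1 + b⁻¹)⁻¹ = (1 + b)⁻¹.
  have e1 : r + jordanInv a = jordanP s (1 + jordanInv (jordanP s a)) := by
    rw [map_add, jordanP_jordanSqrt_one (posCone_subset hε), jordanInv_jordanP hsp ha,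
      jordanP_apply_jordanInv hsp]
  have e2 : jordanP r (jordanInv (r + jordanInv a))
      = jordanP s (jordanInv (1 + jordanInv (jordanP s a))) := by
    rw [e1, jordanInv_jordanP hsp (posCone_add one_mem_posCone (posCone_subset hbi))]
    conv_lhs => rw [← jordanSqrt_mul_self (posCone_subset hε)]
    rw [jordanP_sq, ← hs, jordanP_apply_jordanInv hsp]
  rw [e2, parSum, ← hs, ← one_sub_jordanInv_one_add_inv hb, map_sub, hs,
    jordanP_jordanSqrt_one (posCone_subset hε)]

theorem boxplus_eq {u a : V} (hu : jordanTilde u ∈ squareCone V) (ha : a ∈ posCone V) :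
    boxplus u a = 1 - (2 : ℝ) • parSum (jordanTilde u) a := by
  rw [boxplus, parSum_eq_sub hu ha, smul_sub]
  abel

end ParallelSum

/-! ### The action on the order interval and conditions (C1)–(C3) -/

section Action

variable {V : Type*} [NonAssocCommRing V] [Module ℝ V] [IsScalarTower ℝ V V] [SMulCommClass ℝ V V]
  [IsCommJordan V] [IsEuclideanAlgebra V] [FiniteDimensional ℝ V]

theorem jordanTilde_mem {u : V} (hu : u ∈ orderInterval V) : jordanTilde u ∈ squareCone V :=
  squareCone_smul hu.2 (by norm_num)

theorem one_sub_jordanTilde_mem {u : V} (hu : u ∈ orderInterval V) :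
    1 - jordanTilde u ∈ squareCone V := by
  have h : u - -1 ∈ squareCone V := hu.1
  have := squareCone_smul h (r := 2⁻¹) (by norm_num)
  convert this using 1
  rw [jordanTilde]
  module

theorem one_sub_two_smul_mem {t : V} (ht : t ∈ squareCone V) (ht' : 1 - t ∈ squareCone V) :
    1 - (2 : ℝ) • t ∈ orderInterval V := by
  constructor
  · have := squareCone_smul ht' (r := 2) (by norm_num)
    rw [JordanLE]
    convert this using 1
    module
  · have := squareCone_smul ht (r := 2) (by norm_num)
    rwa [JordanLE, sub_sub_cancel]

theorem jordanTilde_one_sub_two_smul (t : V) : jordanTilde (1 - (2 : ℝ) • t) = t := by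
  rw [jordanTilde]; module

theorem one_sub_two_smul_jordanTilde (u : V) : 1 - (2 : ℝ) • jordanTilde u = u := by
  rw [jordanTilde]; module

theorem jordanTilde_injective : Function.Injective (jordanTilde (V := V)) := fun u v h => by
  rw [← one_sub_two_smul_jordanTilde u, h, one_sub_two_smul_jordanTilde]

theorem exists_squareCone_sub_eq (g : V) : ∃ a ∈ squareCone V, ∃ b ∈ squareCone V, g = a - b := by
  obtain ⟨K, hK, h⟩ := exists_smul_one_sub_mem (-g)
  refine ⟨K • (1 : V) + g, ?_, K • (1 : V), squareCone_smul one_mem_squareCone hK, by abel⟩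
  simpa using h K le_rfl

variable [TopologicalSpace V] [IsTopologicalAddGroup V] [ContinuousSMul ℝ V] [T2Space V]

theorem continuous_jordanTilde : Continuous (jordanTilde (V := V)) := by
  unfold jordanTilde; fun_prop

theorem one_sub_parSum_mem {t a : V} (ht : t ∈ squareCone V) (ht' : 1 - t ∈ squareCone V)
    (ha : a ∈ squareCone V) : 1 - parSum t a ∈ squareCone V := by
  have := squareCone_add ht' (sub_parSum_mem ht ha)
  rwa [sub_add_sub_cancel] at this

/-- The action of the cone of squares on the order interval. -/
noncomputable def boxAction (u : orderInterval V) (a : squareCone V) : orderInterval V :=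
  ⟨1 - (2 : ℝ) • parSum (jordanTilde (u : V)) a,
    one_sub_two_smul_mem (ParDom.of_mem a.2).parSum_mem
      (one_sub_parSum_mem (jordanTilde_mem u.2) (one_sub_jordanTilde_mem u.2) a.2)⟩

theorem jordanTilde_boxAction (u : orderInterval V) (a : squareCone V) :
    jordanTilde (boxAction u a : V) = parSum (jordanTilde (u : V)) a :=
  jordanTilde_one_sub_two_smul _

theorem boxAction_eq_iff {u v : orderInterval V} {a b : squareCone V} :
    boxAction u a = boxAction v b ↔
      parSum (jordanTilde (u : V)) a = parSum (jordanTilde (v : V)) b := by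
  rw [← jordanTilde_boxAction, ← jordanTilde_boxAction, jordanTilde_injective.eq_iff,
    Subtype.ext_iff]

theorem continuous_boxAction :
    Continuous fun p : orderInterval V × squareCone V => boxAction p.1 p.2 := by
  refine Continuous.subtype_mk ?_ _
  refine continuous_const.sub (Continuous.const_smul ?_ _)
  refine continuous_iff_continuousAt.2 fun p => ?_
  refine tendsto_parSum (jordanTilde_mem p.1.2) (ParDom.of_mem p.2.2)
    ((continuous_jordanTilde.comp (continuous_subtype_val.comp continuous_fst)).tendsto p)
    (Filter.Eventually.of_forall fun q => jordanTilde_mem q.1.2)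
    ((continuous_subtype_val.comp continuous_snd).tendsto p)

theorem isInjectiveAction_boxAction : IsInjectiveAction (boxAction (V := V)) where
  continuous := continuous_boxAction
  act_add u a b c hc := by
    rw [boxAction_eq_iff, jordanTilde_boxAction, parSum_parSum (jordanTilde_mem u.2)
      (ParDom.of_mem a.2), hc]
    exact ParDom.of_mem (squareCone_add a.2 b.2)
  act_zero u o ho := by
    refine Subtype.ext (jordanTilde_injective ?_)
    rw [jordanTilde_boxAction, ho, parSum_zero (jordanTilde_mem u.2)]
  injective a u v h := by
    have h' := boxAction_eq_iff.1 h
    refine Subtype.ext (jordanTilde_injective ?_)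
    rw [← parSum_parSum_neg (jordanTilde_mem u.2) (ParDom.of_mem a.2), h',
      parSum_parSum_neg (jordanTilde_mem v.2) (ParDom.of_mem a.2)]

theorem extendsBoxplus_boxAction : ExtendsBoxplus (boxAction (V := V)) := by
  intro u a ha
  rw [interior_squareCone] at ha
  exact (boxplus_eq (jordanTilde_mem u.2) ha).symm

theorem squareCone_subset_closure_interior :
    squareCone V ⊆ closure (interior (squareCone V)) := by
  intro x hx
  rw [interior_squareCone]
  exact mem_closure_of_tendsto (tendsto_add_smul_one x) (eventually_add_smul_one_mem hx)

theorem isSolidOreSemigroup_squareCone : IsSolidOreSemigroup (squareCone V) where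
  isTopologicalAddGroup := inferInstance
  locallyCompactSpace :=
    let e := (Module.finBasis ℝ V).equivFun.toContinuousLinearEquiv.toHomeomorph
    e.isClosedEmbedding.locallyCompactSpace
  t2Space := inferInstance
  secondCountableTopology :=
    (Module.finBasis ℝ V).equivFun.toContinuousLinearEquiv.toHomeomorph.secondCountableTopology
  zero_mem := zero_mem_squareCone
  add_mem _ ha _ hb := squareCone_add ha hb
  isClosed := isClosed_squareCone
  solid := squareCone_subset_closure_interior
  ore := exists_squareCone_sub_eq

theorem orderInterval_eq_image : orderInterval V =
    (fun t => 1 - (2 : ℝ) • t) '' {t | t ∈ squareCone V ∧ 1 - t ∈ squareCone V} := by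
  ext u
  constructor
  · exact fun hu => ⟨jordanTilde u, ⟨jordanTilde_mem hu, one_sub_jordanTilde_mem hu⟩,
      one_sub_two_smul_jordanTilde u⟩
  · rintro ⟨t, ht, rfl⟩
    exact one_sub_two_smul_mem ht.1 ht.2

theorem isCompact_orderInterval : IsCompact (orderInterval V) := by
  rw [orderInterval_eq_image]
  exact (isCompact_squareCone_Icc (1 : V)).image (by fun_prop)

/-- If r ≤ 1 - δ, take b = δ · 1 and act on r by -b: each spectral value ρ becomes ρ/(1 - δρ), which
is at most 1 because ρ(1 + δ) ≤ 1. -/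
theorem exists_parSum_eq {r : V} (hr : r ∈ squareCone V) (hr' : 1 - r ∈ posCone V) :
    ∃ b ∈ posCone V, ∃ t ∈ squareCone V, 1 - t ∈ squareCone V ∧ parSum t b = r := by
  obtain ⟨δ, hδ, h⟩ := hr'
  have h1 := posCone_smul (one_mem_posCone (V := V)) hδ
  suffices hs : ParDom r (-(δ • (1 : V))) ∧ 1 - parSum r (-(δ • (1 : V))) ∈ squareCone V by
    refine ⟨δ • (1 : V), h1, parSum r (-(δ • (1 : V))), hs.1.parSum_mem, hs.2, ?_⟩
    have := parSum_parSum_neg hr hs.1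
    rwa [neg_neg] at this
  obtain ⟨S, c, hc, rfl⟩ := exists_frameSum_eq r
  rw [hc.frameSum_mem_squareCone_iff] at hr
  rw [← hc.frameSum_const, ← hc.frameSum_one, frameSum_sub, frameSum_sub,
    hc.frameSum_mem_squareCone_iff] at h
  have hneg : -(δ • (1 : V)) = frameSum c fun _ => -δ := by
    rw [hc.frameSum_const, neg_smul]
  have hlt : ∀ i : S, (i : ℝ) * (1 + δ) ≤ 1 := fun i => by
    have := h i
    nlinarith [hr i]
  have hpos : ∀ i : S, 0 < 1 + (i : ℝ) * -δ := fun i => by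
    have := h i
    nlinarith [hr i, hlt i]
  rw [hneg]
  refine ⟨(hc.parDom_frameSum_iff _ hr).2 hpos, ?_⟩
  rw [hc.parSum_frameSum hr hpos, ← hc.frameSum_one, frameSum_sub, hc.frameSum_mem_squareCone_iff]
  intro i
  rw [sub_nonneg, div_le_one (hpos i)]
  linarith [hlt i]

/-- Monotonicity bounds the value by the one at t = 1, which is (1 + b)⁻¹ < 1. -/
theorem one_sub_parSum_mem_posCone {t b : V} (ht : t ∈ squareCone V) (ht' : 1 - t ∈ squareCone V)
    (hb : b ∈ posCone V) : 1 - parSum t b ∈ posCone V := by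
  have hd1 : ParDom (1 : V) b := ParDom.of_mem (posCone_subset hb)
  have h1 : parSum 1 b = jordanInv (1 + b) := by
    rw [parSum_eq one_mem_posCone hd1, jordanInv_one]
  have h2 := parSum_mono ht ht' (ParDom.of_mem (posCone_subset hb)) hd1
  refine posCone_of_sub_mem (one_sub_jordanInv_one_add_mem hb) ?_
  rw [← h1]
  convert h2 using 1
  abel

/-- Acting by -a reduces to a = 0, where the two preceding lemmas identify the points u ⊞ b with b
in the open cone as those with coordinate strictly below 1. The right-hand side is visibly open in
z. -/
theorem mem_boxAction_interior_iff (a : squareCone V) (z : orderInterval V) :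
    (∃ (u : orderInterval V) (b c : squareCone V), (b : V) ∈ interior (squareCone V) ∧
      (c : V) = b + a ∧ z = boxAction u c) ↔
    ParDom (jordanTilde (z : V)) (-a) ∧
      1 - parSum (jordanTilde (z : V)) (-a) ∈ posCone V := by
  rw [interior_squareCone]
  constructor
  · rintro ⟨u, b, c, hb, hc, rfl⟩
    have hub : ParDom (jordanTilde (u : V)) b := ParDom.of_mem b.2
    have hba : ParDom (jordanTilde (u : V)) (b + a) := ParDom.of_mem (squareCone_add b.2 a.2)
    have hda : ParDom (parSum (jordanTilde (u : V)) b) a := ParDom.of_mem a.2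
    rw [jordanTilde_boxAction, hc, ← parSum_parSum (jordanTilde_mem u.2) hub hba]
    refine ⟨parDom_parSum_neg hub.parSum_mem hda, ?_⟩
    rw [parSum_parSum_neg hub.parSum_mem hda]
    exact one_sub_parSum_mem_posCone (jordanTilde_mem u.2) (one_sub_jordanTilde_mem u.2) hb
  · rintro ⟨hd, hp⟩
    obtain ⟨b, hb, t, ht, ht', hr⟩ := exists_parSum_eq hd.parSum_mem hp
    refine ⟨⟨_, one_sub_two_smul_mem ht ht'⟩, ⟨b, posCone_subset hb⟩,
      ⟨b + a, squareCone_add (posCone_subset hb) a.2⟩, hb, rfl, ?_⟩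
    refine Subtype.ext (jordanTilde_injective ?_)
    have h := parSum_parSum_neg (jordanTilde_mem z.2) hd
    rw [neg_neg, ← hr, parSum_parSum ht (ParDom.of_mem (posCone_subset hb))
      (ParDom.of_mem (squareCone_add (posCone_subset hb) a.2))] at h
    rw [jordanTilde_boxAction, jordanTilde_one_sub_two_smul, h]

theorem isOpen_boxAction_interior (a : squareCone V) : IsOpen {z : orderInterval V |
    ∃ (u : orderInterval V) (b c : squareCone V), (b : V) ∈ interior (squareCone V) ∧
      (c : V) = b + a ∧ z = boxAction u c} := by
  rw [isOpen_iff_mem_nhds]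
  intro z hz
  obtain ⟨hd, hp⟩ := (mem_boxAction_interior_iff a z).1 hz
  have hz' : Filter.Tendsto (fun w : orderInterval V => jordanTilde (w : V)) (𝓝 z)
      (𝓝 (jordanTilde (z : V))) := (continuous_jordanTilde.comp continuous_subtype_val).tendsto z
  have hQ : ∀ᶠ w : orderInterval V in 𝓝 z, jordanTilde (w : V) ∈ squareCone V :=
    Filter.Eventually.of_forall fun w => jordanTilde_mem w.2
  have h1 := eventually_parDom (jordanTilde_mem z.2) hd hz' hQ (tendsto_const_nhds (x := -(a : V)))
  have h2 := ((tendsto_parSum (jordanTilde_mem z.2) hd hz' hQ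
    (tendsto_const_nhds (x := -(a : V)))).const_sub 1).eventually (isOpen_posCone.mem_nhds hp)
  filter_upwards [h1, h2] with w hw1 hw2
  exact (mem_boxAction_interior_iff a w).2 ⟨hw1, hw2⟩

/-- Solving u ⊞ a = v ⊞ b for v forces the coordinate of v to be `parSum` of that of u at a - b;
only membership in X remains to be required. -/
theorem mem_translationSet_boxAction_iff (u : orderInterval V) (g : V) :
    g ∈ translationSet boxAction u ↔
      ParDom (jordanTilde (u : V)) g ∧ 1 - parSum (jordanTilde (u : V)) g ∈ squareCone V := by
  have hu := jordanTilde_mem u.2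
  constructor
  · rintro ⟨a, b, v, rfl, h⟩
    rw [boxAction_eq_iff] at h
    have hv := jordanTilde_mem v.2
    have hua : ParDom (jordanTilde (u : V)) a := ParDom.of_mem a.2
    have hvb : ParDom (jordanTilde (v : V)) b := ParDom.of_mem b.2
    have hd : ParDom (jordanTilde (u : V)) (a - b) := by
      rw [sub_eq_add_neg, ← parDom_parSum_iff hu hua, h]
      exact parDom_parSum_neg hv hvb
    refine ⟨hd, ?_⟩
    rw [sub_eq_add_neg (a : V)] at hd ⊢
    rw [← parSum_parSum hu hua hd, h, parSum_parSum_neg hv hvb]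
    exact one_sub_jordanTilde_mem v.2
  · rintro ⟨hd, hp⟩
    obtain ⟨a, ha, b, hb, rfl⟩ := exists_squareCone_sub_eq g
    refine ⟨⟨a, ha⟩, ⟨b, hb⟩, ⟨_, one_sub_two_smul_mem hd.parSum_mem hp⟩, rfl, ?_⟩
    rw [boxAction_eq_iff]
    simp only [jordanTilde_one_sub_two_smul]
    rw [parSum_parSum hu hd] <;> rw [sub_add_cancel]
    exact ParDom.of_mem ha

theorem neg_one_mem_orderInterval : (-1 : V) ∈ orderInterval V := by
  have h := one_sub_two_smul_mem (one_mem_squareCone (V := V)) (by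
    rw [sub_self]; exact zero_mem_squareCone)
  convert h using 1
  module

theorem jordanTilde_neg_one : jordanTilde (-1 : V) = 1 := by
  rw [jordanTilde]; module

theorem translationSet_boxAction_neg_one :
    translationSet boxAction (⟨-1, neg_one_mem_orderInterval⟩ : orderInterval V)
      = squareCone V := by
  ext g
  rw [mem_translationSet_boxAction_iff]
  simp only [jordanTilde_neg_one]
  constructor
  · rintro ⟨hd, hp⟩
    have h1 := (parDom_iff one_mem_posCone g).1 hd
    rw [parSum_eq one_mem_posCone hd] at hp
    rw [jordanInv_one] at h1 hp
    have h2 := sub_inv_smul_one_mem_of_jordanInv_le h1 (K := 1) (by rwa [one_smul])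
    rwa [inv_one, one_smul, add_sub_cancel_left] at h2
  · intro hg
    exact ⟨ParDom.of_mem hg, sub_parSum_mem one_mem_squareCone hg⟩

theorem dense_range_boxAction_neg_one :
    Dense (range (boxAction (⟨-1, neg_one_mem_orderInterval⟩ : orderInterval V))) := by
  intro u
  rw [closure_subtype]
  set t := jordanTilde (u : V) with ht
  have htQ : t ∈ squareCone V := jordanTilde_mem u.2
  have htQ' : 1 - t ∈ squareCone V := one_sub_jordanTilde_mem u.2
  -- Moving t towards 1 makes it invertible without leaving the interval; the new point is reached
  -- from 1 by the element p⁻¹ - 1, with p = t + ε(1 - t).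
  have hlim : Filter.Tendsto (fun ε : ℝ => 1 - (2 : ℝ) • (t + ε • (1 - t))) (𝓝[>] 0)
      (𝓝 (u : V)) := by
    have hc : Continuous fun ε : ℝ => 1 - (2 : ℝ) • (t + ε • (1 - t)) := by fun_prop
    have := (hc.tendsto 0).mono_left (nhdsWithin_le_nhds (s := Ioi 0))
    rwa [zero_smul, add_zero, one_sub_two_smul_jordanTilde] at this
  refine mem_closure_of_tendsto hlim ?_
  have hlt : ∀ᶠ ε in 𝓝[>] (0 : ℝ), ε < 1 := nhdsWithin_le_nhds (eventually_lt_nhds one_pos)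
  filter_upwards [self_mem_nhdsWithin, hlt] with ε hε hε1
  have hε0 : 0 < ε := hε
  have hp : t + ε • (1 - t) ∈ posCone V := by
    have := posCone_add (posCone_smul one_mem_posCone hε0)
      (squareCone_smul htQ (sub_nonneg.2 hε1.le))
    convert this using 1
    module
  have hp' : 1 - (t + ε • (1 - t)) ∈ squareCone V := by
    have := squareCone_smul htQ' (sub_nonneg.2 hε1.le)
    convert this using 1
    module
  have ha : jordanInv (t + ε • (1 - t)) - 1 ∈ squareCone V := by
    have := jordanInv_antitone hp hp'
    rwa [jordanInv_one] at this
  refine ⟨boxAction ⟨-1, neg_one_mem_orderInterval⟩ ⟨_, ha⟩, ⟨_, rfl⟩, ?_⟩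
  refine jordanTilde_injective ?_
  rw [jordanTilde_boxAction, jordanTilde_one_sub_two_smul]
  simp only [jordanTilde_neg_one]
  rw [parSum_eq one_mem_posCone (ParDom.of_mem ha), jordanInv_one, add_sub_cancel,
    jordanInv_jordanInv hp]

/-- Supplies a nearly extremal element of A_u. For invertible t the condition t⁻¹ + g ≥ 1 would
allow g = 1 - t⁻¹; the shift by ε covers singular t. -/
theorem parDom_one_sub_jordanInv {t : V} (ht : t ∈ squareCone V) {ε : ℝ} (hε : 0 < ε) :
    ParDom t (1 - jordanInv (t + ε • (1 : V))) ∧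
      1 - parSum t (1 - jordanInv (t + ε • (1 : V))) ∈ squareCone V := by
  obtain ⟨S, c, hc, rfl⟩ := exists_frameSum_eq t
  rw [hc.frameSum_mem_squareCone_iff] at ht
  have h0 : ∀ i : S, 0 < (i : ℝ) + ε := fun i => by linarith [ht i]
  rw [← hc.frameSum_const, frameSum_add, hc.jordanInv_frameSum fun i => (h0 i).ne',
    ← hc.frameSum_one, frameSum_sub]
  have hle : ∀ i : S, (i : ℝ) * ((i : ℝ) + ε)⁻¹ < 1 := fun i => by
    rw [← div_eq_mul_inv, div_lt_one (h0 i)]; linarith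
  have hpos : ∀ i : S, 0 < 1 + (i : ℝ) * (1 - ((i : ℝ) + ε)⁻¹) := fun i => by
    have := hle i
    have := ht i
    rw [mul_sub]
    linarith
  refine ⟨(hc.parDom_frameSum_iff _ ht).2 hpos, ?_⟩
  rw [hc.parSum_frameSum ht hpos, frameSum_sub, hc.frameSum_mem_squareCone_iff]
  intro i
  rw [sub_nonneg, div_le_one (hpos i), mul_sub]
  linarith [hle i]

/-- Test with g = 1 - (ũ + ε)⁻¹. Membership in A_v gives `parSum ṽ g` ≤ 1, and acting by -g yields ṽ
≤ (1 - g)⁻¹ = ũ + ε. -/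
theorem jordanTilde_sub_mem_of_translationSet_subset {u v : orderInterval V}
    (h : translationSet boxAction u ⊆ translationSet boxAction v) :
    jordanTilde (u : V) - jordanTilde (v : V) ∈ squareCone V := by
  have hu := jordanTilde_mem u.2
  have hv := jordanTilde_mem v.2
  refine isClosed_squareCone.mem_of_tendsto
    ((tendsto_add_smul_one (jordanTilde (u : V))).sub_const (jordanTilde (v : V))) ?_
  filter_upwards [self_mem_nhdsWithin] with ε hε
  have hp := add_smul_one_mem_posCone hu hε
  set g := 1 - jordanInv (jordanTilde (u : V) + ε • (1 : V)) with hg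
  obtain ⟨hd, hle⟩ := (mem_translationSet_boxAction_iff v g).1
    (h ((mem_translationSet_boxAction_iff u g).2 (parDom_one_sub_jordanInv hu hε)))
  have hone : 1 + -g = jordanInv (jordanTilde (u : V) + ε • (1 : V)) := by rw [hg]; abel
  have hd1 : ParDom (1 : V) (-g) := by
    rw [parDom_iff one_mem_posCone, jordanInv_one, hone]
    exact jordanInv_mem_posCone hp
  have h1 := parSum_mono hd.parSum_mem hle (parDom_parSum_neg hv hd) hd1
  rwa [parSum_parSum_neg hv hd, parSum_eq one_mem_posCone hd1, jordanInv_one, hone,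
    jordanInv_jordanInv hp] at h1

theorem isWienerHopfCompactification_boxAction :
    IsWienerHopfCompactification (boxAction (V := V)) where
  semigroup := isSolidOreSemigroup_squareCone
  compactSpace := isCompact_iff_compactSpace.1 isCompact_orderInterval
  t2Space := inferInstance
  action := isInjectiveAction_boxAction
  c1 := isOpen_boxAction_interior
  c2 := ⟨⟨-1, neg_one_mem_orderInterval⟩, translationSet_boxAction_neg_one,
    dense_range_boxAction_neg_one⟩
  c3 u v h := by
    refine Subtype.ext (jordanTilde_injective (sub_eq_zero.1
      (eq_zero_of_mem_squareCone_of_neg_mem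
        (jordanTilde_sub_mem_of_translationSet_subset h.subset) ?_)))
    rw [neg_sub]
    exact jordanTilde_sub_mem_of_translationSet_subset h.symm.subset

theorem ExtendsBoxplus.eq_of_isInjectiveAction
    {τ τ' : orderInterval V → squareCone V → orderInterval V} (hτ : IsInjectiveAction τ)
    (hτ' : IsInjectiveAction τ') (h : ExtendsBoxplus τ) (h' : ExtendsBoxplus τ') : τ' = τ := by
  funext u
  have hdense : Dense {a : squareCone V | (a : V) ∈ interior (squareCone V)} := by
    intro a
    rw [closure_subtype]
    refine closure_mono ?_ (squareCone_subset_closure_interior a.2)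
    exact fun x hx => ⟨⟨x, interior_subset hx⟩, hx, rfl⟩
  refine Continuous.ext_on hdense (hτ'.continuous.comp (Continuous.prodMk_right u))
    (hτ.continuous.comp (Continuous.prodMk_right u)) fun a ha => ?_
  exact Subtype.ext ((h' u a ha).trans (h u a ha).symm)

end Action

theorem mainTheorem1 (V : Type*) [NonAssocCommRing V] [Module ℝ V] [IsScalarTower ℝ V V]
    [SMulCommClass ℝ V V] [IsCommJordan V] [IsEuclideanAlgebra V] [FiniteDimensional ℝ V]
    [TopologicalSpace V] [IsTopologicalAddGroup V] [ContinuousSMul ℝ V] [T2Space V] :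
    -- the inverses in the formula for `u ⊞ a` exist
    (∀ u ∈ orderInterval V, ∀ a ∈ interior (squareCone V),
      IsJordanInvertible a ∧ IsJordanInvertible (jordanTilde u + jordanInv a)) ∧
    -- the order interval is the Wiener-Hopf compactification of `Q`, for the unique
    -- injective action of `Q` that is given by `u ⊞ a` for `a` in the interior of `Q`
    ∃ τ : orderInterval V → squareCone V → orderInterval V,
      ExtendsBoxplus τ ∧ IsWienerHopfCompactification τ ∧
      ∀ τ' : orderInterval V → squareCone V → orderInterval V,
        IsInjectiveAction τ' → ExtendsBoxplus τ' → τ' = τ := by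
  refine ⟨fun u hu a ha => ?_, boxAction, extendsBoxplus_boxAction,
    isWienerHopfCompactification_boxAction, fun τ' h1 h2 =>
      extendsBoxplus_boxAction.eq_of_isInjectiveAction isInjectiveAction_boxAction h1 h2⟩
  rw [interior_squareCone] at ha
  refine ⟨isJordanInvertible_of_mem_posCone ha, isJordanInvertible_of_mem_posCone ?_⟩
  rw [add_comm]
  exact posCone_add (jordanInv_mem_posCone ha) (jordanTilde_mem hu)
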